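/- **$q$-rationals.** For $n\in\mathbb Z$ put $\{n\}=\frac{q^{2n}-1}{q^2-1}$ and $\{n\}_{q^{-2}}=\frac{q^{-2n}-1}{q^{-2}-1}$ in $\mathbb Q(q)$. For $x\in\mathbb Q$ with continued fraction expansion $[a_1,\dots,a_n]$ of even length ($a_1\in\mathbb Z$, $a_2,\dots,a_n\ge 1$) put $$\{x\}=\{a_1\}+\cfrac{q^{2a_1}}{\{a_2\}_{q^{-2}}+\cfrac{q^{-2a_2}}{\{a_3\}+\cfrac{q^{2a_3}}{\ddots+\cfrac{q^{2a_{n-1}}}{\{a_n\}_{q^{-2}}}}}},\qquad \binom{x}{k}_q=\frac{\{x\}\{x-1\}\cdots\{x-k+1\}}{\{k\}\{k-1\}\cdots\{1\}},\qquad \delta_x=\{x\}-\{x-1\}.$$ **Webs.** Let $R$ be a commutative $\mathbb Q(q)$-algebra and $a\in R^\times$. The web category over $(R,a)$ is the $R$-linear pivotal monoidal category whose objects are words in upward and downward arrows labelled by positive integers and whose morphisms are $R$-linear combinations of oriented labelled trivalent planar graphs (generated by the vertices $k\otimes l\to k+l$ and $k+l\to k\otimes l$, cups and caps), up to planar isotopy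 and the following relations (edges labelled $0$ are erased, webs with an edge of negative label are zero): associativity and coassociativity of the vertices; the digon $k+l\to k\otimes l\to k+l$ equals $q^{-kl}\binom{k+l}{k}_q$; with $F^{(b)}$, $E^{(b)}$ denoting the ladders with one rung labelled $b$ directed to the right, respectively to the left, $EF-FE=q^{1-k+l}\{k-l\}$ on uprights $k,l$, and the cubic Serre relations between ladders on three uprights; a circle labelled $1$ equals $\frac{a-a^{-1}}{q-q^{-1}}$ in both orientations; closing one strand (on the right or on the left) of the web $1\otimes1\to2\to1\otimes1$ gives $\frac{aq^{-1}-a^{-1}q}{q-q^{-1}}$ times the identity; and the mixed square of edges $1,2,1,2$ equals the identity plus $\frac{aq^{-2}-a^{-1}q^2}{q-q^{-1}}$ times the cap followed by the cup, together with the mirror image. A crossing of upward strands labelled $k$ (starting bottom left) and $l$ (starting bottom right) is sent to $$(-q)^{kl}\sum_{\substack{b,c\ge0\\ b-c=k-l}}(-q)^{b-k}E^{(c)}F^{(b)}\quad\text{if the strand labelled }k\text{ is over},\qquad (-q)^{-kl}\sum_{\substack{b,c\ge0\\ b-c=l-k}}(-q)^{l-b}F^{(c)}E^{(b)}\quad\text{if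 it is under.}$$ Thus a coloured link diagram has a value in $\mathrm{End}(\emptyset)$. For $R=\mathbb Q(q)[a^{\pm1}]$ this value, a multiple of the identity, is its (framed, coloured) HOMFLY-PT polynomial. For $x\in\mathbb Q$ and an element $\nu_x$ of a commutative $\mathbb Q(q)$-algebra $R$ with $\nu_x^2=\delta_x^{-1}$ (for instance $R=\mathbb Q(q)[\nu_x]$), the $x$-invariant $[D]_x\in R$ is the specialization of the HOMFLY-PT polynomial of $D$ at $a=q\nu_x\delta_x$; equivalently it is the scalar by which $D$ acts in the web category over $(R,q\nu_x\delta_x)$. **Statement.** For $k\ge1$ let $U_k$ be the once stabilized unknot coloured by $k$: the figure-eight diagram with one crossing, whose two strands both point upwards at the crossing, with the strand from bottom right to top left over, the left ends being joined around the left and the right ends around the right. Then for every $x\in\mathbb Q$ $$[U_1]_x=\{x\},\qquad\text{and more generally}\qquad [U_k]_x=q^{-k(k-1)}\binom{x}{k}_q\quad\text{for all }k\ge1 .$$ -/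

import Mathlib

open CategoryTheory MonoidalCategory
open scoped LaurentPolynomial

universe u

namespace QWeb

noncomputable section

/-! ### `q`-integers and `q`-rationals

The ground field is `ℚ(q)`; the variable of the usual `q`-rationals is `q ^ 2` here. -/

/-- The field of rational fractions `ℚ(q) = Frac ℤ[q]`. -/
abbrev Kq : Type := RatFunc ℚ

/-- The indeterminate `q`. -/
def q : Kq := RatFunc.X

/-- `{n} = (q^{2n} - 1) / (q^2 - 1)` for `n ∈ ℤ`. -/
def qInt (n : ℤ) : Kq := (q ^ (2 * n) - 1) / (q ^ 2 - 1)

/-- `{n}_{q^{-2}} = (q^{-2n} - 1) / (q^{-2} - 1)`, i.e. `{n}` with `q` replaced by `q⁻¹`. -/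
def qIntInv (n : ℤ) : Kq := (q ^ (-2 * n) - 1) / (q ^ (-2 : ℤ) - 1)

/-- The integral `q`-binomial coefficient
`{n choose k} = {n}{n-1}⋯{n-k+1} / ({k}{k-1}⋯{1})`. -/
def qIntBinom (n : ℤ) (k : ℕ) : Kq :=
  (∏ i ∈ Finset.range k, qInt (n - i)) / ∏ i ∈ Finset.range k, qInt (i + 1)

theorem evenCF_decreasing (x : ℚ) (h : (x - ((⌈x⌉ - 1 : ℤ) : ℚ))⁻¹ ≠
    (⌊(x - ((⌈x⌉ - 1 : ℤ) : ℚ))⁻¹⌋ : ℚ)) :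
    (((x - ((⌈x⌉ - 1 : ℤ) : ℚ))⁻¹ - (⌊(x - ((⌈x⌉ - 1 : ℤ) : ℚ))⁻¹⌋ : ℚ))⁻¹).den < x.den := by
  set r : ℚ := x - ((⌈x⌉ - 1 : ℤ) : ℚ) with hr
  have hr0 : 0 < r := by
    have := Int.ceil_lt_add_one x
    rw [hr]; push_cast; linarith
  have hr1 : r ≤ 1 := by
    have := Int.le_ceil x
    rw [hr]; push_cast; linarith
  have hden : r.den = x.den := by
    rw [hr]; exact Rat.sub_intCast_den x _
  have hf : r⁻¹ - (⌊r⁻¹⌋ : ℚ) = Int.fract r⁻¹ := rfl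
  have hne : Int.fract r⁻¹ ≠ 0 := by
    rw [← hf]; exact sub_ne_zero.mpr h
  have hlt := Rat.fract_inv_num_lt_num_of_pos hr0
  have hle : r.num ≤ r.den := Rat.num_le_denom_iff.mpr hr1
  have hpos : 0 < (Int.fract r⁻¹).num :=
    Rat.num_pos.mpr (lt_of_le_of_ne (Int.fract_nonneg _) hne.symm)
  rw [hf, Rat.den_inv_of_ne_zero hne, ← hden]
  omega

/-- The continued fraction expansion `[a₁, a₂, …, aₙ]` of `x` of even length `n`, with
`a₁ ∈ ℤ` and `a₂, …, aₙ ≥ 1` (see `evenCF_spec`). -/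
def evenCF (x : ℚ) : List ℤ :=
  let a : ℤ := ⌈x⌉ - 1
  let y : ℚ := (x - a)⁻¹
  if _h : y = ⌊y⌋ then [a, ⌊y⌋] else a :: ⌊y⌋ :: evenCF (y - ⌊y⌋)⁻¹
termination_by x.den
decreasing_by exact evenCF_decreasing x _h

/-- The value `a₁ + 1 / (a₂ + 1 / (a₃ + ⋯))` of a finite continued fraction. -/
def cfValue : List ℤ → ℚ
  | [] => 0
  | [a] => a
  | a :: b :: l => a + 1 / cfValue (b :: l)

theorem evenCF_ne_nil (x : ℚ) : evenCF x ≠ [] := by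
  rw [evenCF]; split <;> simp

theorem evenCF_spec (x : ℚ) :
    Even (evenCF x).length ∧ (∀ b ∈ (evenCF x).tail, 1 ≤ b) ∧ cfValue (evenCF x) = x ∧
      (1 < x → ∀ b ∈ evenCF x, 1 ≤ b) := by
  induction hn : x.den using Nat.strong_induction_on generalizing x with
  | _ n ih =>
  have hr0 : (0 : ℚ) < x - ((⌈x⌉ - 1 : ℤ) : ℚ) := by
    have := Int.ceil_lt_add_one x
    push_cast; linarith
  have hr1 : x - ((⌈x⌉ - 1 : ℤ) : ℚ) ≤ 1 := by
    have := Int.le_ceil x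
    push_cast; linarith
  have hy1 : (1 : ℚ) ≤ (x - ((⌈x⌉ - 1 : ℤ) : ℚ))⁻¹ := (one_le_inv₀ hr0).mpr hr1
  have hb : (1 : ℤ) ≤ ⌊(x - ((⌈x⌉ - 1 : ℤ) : ℚ))⁻¹⌋ := Int.le_floor.mpr (by simpa using hy1)
  have ha : 1 < x → (1 : ℤ) ≤ ⌈x⌉ - 1 := fun h => by
    have : (1 : ℤ) < ⌈x⌉ := Int.lt_ceil.mpr (by simpa using h)
    omega
  rw [evenCF]
  split_ifs with h
  · refine ⟨by simp, by simpa using hb, ?_, fun hx b hb' => by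
      simp only [List.mem_cons, List.not_mem_nil, or_false] at hb'
      rcases hb' with rfl | rfl
      · exact ha hx
      · exact hb⟩
    simp only [cfValue]
    rw [← h]; simp
  · set y : ℚ := (x - ((⌈x⌉ - 1 : ℤ) : ℚ))⁻¹ with hy
    have hlt := evenCF_decreasing x h
    obtain ⟨h1, -, h3, h4⟩ := ih _ (hn ▸ hlt) (y - ⌊y⌋)⁻¹ rfl
    have hf0 : 0 < y - ⌊y⌋ :=
      lt_of_le_of_ne (Int.fract_nonneg y) (sub_ne_zero.mpr h).symm
    have hf1 : y - ⌊y⌋ < 1 := Int.fract_lt_one y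
    have hgt : 1 < (y - ⌊y⌋)⁻¹ := (one_lt_inv₀ hf0).mpr hf1
    have h5 := h4 hgt
    refine ⟨by simpa [Nat.even_add_one] using h1, ?_, ?_, ?_⟩
    · intro b hb'
      simp only [List.tail_cons, List.mem_cons] at hb'
      rcases hb' with rfl | hb'
      · exact hb
      · exact h5 b hb'
    · obtain ⟨c, l, hcl⟩ := List.exists_cons_of_ne_nil (evenCF_ne_nil (y - ⌊y⌋)⁻¹)
      rw [hcl] at h3 ⊢
      simp only [cfValue]
      rw [h3, one_div, one_div, inv_inv, add_sub_cancel, hy, inv_inv]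
      ring
    · intro hx b hb'
      simp only [List.mem_cons] at hb'
      rcases hb' with rfl | rfl | hb'
      · exact ha hx
      · exact hb
      · exact h5 b hb'

/-- The `q`-deformed continued fraction
`{a₁} + q^{2a₁} / ({a₂}_{q⁻²} + q^{-2a₂} / ({a₃} + q^{2a₃} / (⋱ + q^{2aₙ₋₁} / {aₙ}_{q⁻²})))`. -/
def qCF : List ℤ → Kq
  | [] => 0
  | [a] => qInt a
  | [a, b] => qInt a + q ^ (2 * a) / qIntInv b
  | a :: b :: c :: l => qInt a + q ^ (2 * a) / (qIntInv b + q ^ (-2 * b) / qCF (c :: l))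

/-- The `q`-rational `{x}` of Morier-Genoud and Ovsienko (in the variable `q ^ 2`). -/
def qRat (x : ℚ) : Kq := qCF (evenCF x)

/-- `{x choose k} = {x}{x-1}⋯{x-k+1} / ({k}{k-1}⋯{1})` for `x ∈ ℚ`. -/
def qBinom (x : ℚ) (k : ℕ) : Kq :=
  (∏ i ∈ Finset.range k, qRat (x - i)) / ∏ i ∈ Finset.range k, qInt (i + 1)

/-- `δ_x = {x} - {x - 1}`. -/
def qDelta (x : ℚ) : Kq := qRat x - qRat (x - 1)

/-! `δ_x` is invertible: `{x}` has no pole at `q = 1` and takes the value `x` there. -/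

/-- The fraction `f` has no pole at `q = 1`, where its value is `v`. -/
def HasValue (f : Kq) (v : ℚ) : Prop :=
  ∃ p r : Polynomial ℚ, r.eval 1 ≠ 0 ∧ p.eval 1 = v * r.eval 1 ∧
    f * algebraMap (Polynomial ℚ) Kq r = algebraMap (Polynomial ℚ) Kq p

theorem HasValue.map_ne_zero {r : Polynomial ℚ} (h : r.eval 1 ≠ 0) :
    algebraMap (Polynomial ℚ) Kq r ≠ 0 := by
  intro h0
  have : r = 0 := (FaithfulSMul.algebraMap_injective (Polynomial ℚ) Kq) (by rw [h0, map_zero])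
  simp [this] at h

theorem HasValue.add {f g : Kq} {v w : ℚ} (hf : HasValue f v) (hg : HasValue g w) :
    HasValue (f + g) (v + w) := by
  obtain ⟨p, r, hr, hp, h⟩ := hf
  obtain ⟨p', r', hr', hp', h'⟩ := hg
  refine ⟨p * r' + p' * r, r * r', by simp [hr, hr'], ?_, ?_⟩
  · simp only [Polynomial.eval_add, Polynomial.eval_mul, hp, hp']; ring
  · simp only [map_add, map_mul, ← h, ← h']; ring

theorem HasValue.mul {f g : Kq} {v w : ℚ} (hf : HasValue f v) (hg : HasValue g w) :
    HasValue (f * g) (v * w) := by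
  obtain ⟨p, r, hr, hp, h⟩ := hf
  obtain ⟨p', r', hr', hp', h'⟩ := hg
  refine ⟨p * p', r * r', by simp [hr, hr'], ?_, ?_⟩
  · simp only [Polynomial.eval_mul, hp, hp']; ring
  · simp only [map_mul, ← h, ← h']; ring

theorem HasValue.inv {f : Kq} {v : ℚ} (hf : HasValue f v) (hv : v ≠ 0) :
    HasValue f⁻¹ v⁻¹ := by
  obtain ⟨p, r, hr, hp, h⟩ := hf
  have hp0 : p.eval 1 ≠ 0 := by rw [hp]; exact mul_ne_zero hv hr
  have hf0 : f ≠ 0 := by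
    rintro rfl
    rw [zero_mul] at h
    exact HasValue.map_ne_zero hp0 h.symm
  refine ⟨r, p, hp0, ?_, ?_⟩
  · rw [hp, inv_mul_cancel_left₀ hv]
  · rw [← h, inv_mul_cancel_left₀ hf0]

theorem HasValue.div {f g : Kq} {v w : ℚ} (hf : HasValue f v) (hg : HasValue g w)
    (hw : w ≠ 0) : HasValue (f / g) (v / w) := by
  rw [div_eq_mul_inv, div_eq_mul_inv]; exact hf.mul (hg.inv hw)

theorem HasValue.ne_zero {f : Kq} {v : ℚ} (hf : HasValue f v) (hv : v ≠ 0) : f ≠ 0 := by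
  obtain ⟨p, r, hr, hp, h⟩ := hf
  rintro rfl
  rw [zero_mul] at h
  exact HasValue.map_ne_zero (by rw [hp]; exact mul_ne_zero hv hr) h.symm

theorem hasValue_one : HasValue 1 1 := ⟨1, 1, by simp, by simp, by simp⟩

theorem hasValue_neg_one : HasValue (-1) (-1) := ⟨-1, 1, by simp, by simp, by simp⟩

theorem hasValue_q : HasValue q 1 := ⟨Polynomial.X, 1, by simp, by simp, by simp [q]⟩

theorem hasValue_q_pow (n : ℕ) : HasValue (q ^ n) 1 := by
  induction n with
  | zero => simpa using hasValue_one
  | succ n ih => simpa [pow_succ] using ih.mul hasValue_q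

theorem hasValue_q_zpow (n : ℤ) : HasValue (q ^ n) 1 := by
  obtain ⟨m, rfl | rfl⟩ := n.eq_nat_or_neg
  · simpa using hasValue_q_pow m
  · simpa using (hasValue_q_pow m).inv one_ne_zero

theorem q_ne_zero : q ≠ 0 := RatFunc.X_ne_zero

theorem q_pow_ne_one {n : ℕ} (hn : n ≠ 0) : q ^ n ≠ 1 := by
  intro h
  have h2 : (Polynomial.X ^ n : Polynomial ℚ) = 1 :=
    (FaithfulSMul.algebraMap_injective (Polynomial ℚ) Kq) (by
      simpa [q, RatFunc.algebraMap_X] using h)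
  have := congrArg Polynomial.natDegree h2
  simp at this
  exact hn this

theorem q_sub_inv_ne_zero : q - q⁻¹ ≠ 0 := by
  intro h
  apply q_pow_ne_one two_ne_zero
  have h' := sub_eq_zero.mp h
  rw [pow_two]
  nth_rewrite 2 [h']
  exact mul_inv_cancel₀ q_ne_zero

theorem hasValue_geom (z : Kq) (hz : ∀ n : ℤ, HasValue (z ^ n) 1) (h0 : z ≠ 0) (h1 : z ≠ 1)
    (n : ℤ) : HasValue ((z ^ n - 1) / (z - 1)) n := by
  have h1' : z - 1 ≠ 0 := sub_ne_zero.mpr h1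
  have key : ∀ m : ℕ, HasValue ((z ^ m - 1) / (z - 1)) m := by
    intro m
    induction m with
    | zero => exact ⟨0, 1, by simp, by simp, by simp⟩
    | succ m ih =>
      have e : (z ^ (m + 1) - 1) / (z - 1) = (z ^ m - 1) / (z - 1) + z ^ m := by
        field_simp; ring
      rw [e]
      push_cast
      exact ih.add (by simpa using hz m)
  obtain ⟨m, rfl | rfl⟩ := n.eq_nat_or_neg
  · simpa using key m
  · have e : (z ^ (-(m : ℤ)) - 1) / (z - 1) =
        (-1) * (z ^ (-(m : ℤ)) * ((z ^ m - 1) / (z - 1))) := by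
      rw [zpow_neg, zpow_natCast]
      have := pow_ne_zero m h0
      field_simp; ring
    rw [e]
    have := hasValue_neg_one.mul ((hz (-(m : ℤ))).mul (key m))
    simpa using this

theorem hasValue_qInt (n : ℤ) : HasValue (qInt n) n := by
  have h := hasValue_geom (q ^ 2) (fun n => by
    have := hasValue_q_zpow (2 * n)
    rwa [zpow_mul] at this) (pow_ne_zero _ q_ne_zero) (q_pow_ne_one two_ne_zero) n
  rw [qInt, zpow_mul]; exact h

theorem hasValue_qIntInv (n : ℤ) : HasValue (qIntInv n) n := by
  have h := hasValue_geom (q ^ (-2 : ℤ)) (fun n => by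
    have := hasValue_q_zpow (-2 * n)
    rwa [zpow_mul] at this) (zpow_ne_zero _ q_ne_zero) (by
      rw [zpow_neg, ne_eq, inv_eq_one]
      exact q_pow_ne_one two_ne_zero) n
  rw [qIntInv, zpow_mul]; exact h

theorem cfValue_pos (l : List ℤ) (hl : l ≠ []) (h : ∀ b ∈ l, 1 ≤ b) : 0 < cfValue l := by
  induction l using cfValue.induct with
  | case1 => exact absurd rfl hl
  | case2 a =>
    have : 1 ≤ a := h a (by simp)
    simp only [cfValue]; exact_mod_cast (by omega : 0 < a)
  | case3 a b l ih =>
    have h1 : (1 : ℤ) ≤ a := h a (by simp)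
    have h2 := ih (by simp) (fun c hc => h c (by simp [hc]))
    have h3 : (0 : ℚ) < a := by exact_mod_cast (by omega : 0 < a)
    simp only [cfValue]; positivity

theorem hasValue_qCF (l : List ℤ) (h : ∀ b ∈ l.tail, 1 ≤ b) :
    HasValue (qCF l) (cfValue l) := by
  induction l using qCF.induct with
  | case1 => exact ⟨0, 1, by simp, by simp [cfValue], by simp [qCF]⟩
  | case2 a => simpa [qCF, cfValue] using hasValue_qInt a
  | case3 a b =>
    have hb : 1 ≤ b := h b (by simp)
    simp only [qCF, cfValue]
    exact (hasValue_qInt a).add ((hasValue_q_zpow _).div (hasValue_qIntInv b)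
      (by exact_mod_cast (by omega : b ≠ 0)))
  | case4 a b c l ih =>
    have h2 : ∀ d ∈ c :: l, 1 ≤ d := fun d hd => h d (by
      simp only [List.tail_cons]; exact List.mem_cons_of_mem _ hd)
    have p1 := cfValue_pos (c :: l) (by simp) h2
    have p2 := cfValue_pos (b :: c :: l) (by simp) (by simpa using h)
    have ih' := ih (fun d hd => h2 d (List.mem_of_mem_tail hd))
    simp only [qCF, cfValue] at p2 ⊢
    exact (hasValue_qInt a).add ((hasValue_q_zpow _).div
      ((hasValue_qIntInv b).add ((hasValue_q_zpow _).div ih' p1.ne')) p2.ne')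

theorem hasValue_qRat (x : ℚ) : HasValue (qRat x) x := by
  obtain ⟨-, h2, h3, -⟩ := evenCF_spec x
  have := hasValue_qCF (evenCF x) h2
  rwa [h3] at this

theorem qDelta_ne_zero (x : ℚ) : qDelta x ≠ 0 := by
  have h := (hasValue_qRat x).add (hasValue_neg_one.mul (hasValue_qRat (x - 1)))
  have e : qRat x + -1 * qRat (x - 1) = qDelta x := by rw [qDelta]; ring
  rw [e] at h
  exact h.ne_zero (by ring_nf; norm_num)

/-! ### Webs -/

/-- Objects: words in upward and downward arrows with positive labels. `gen j` is the upward and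
`cogen j` the downward arrow with label `j + 1`. -/
inductive Obj : Type
  | unit : Obj
  | tensor : Obj → Obj → Obj
  | gen : ℕ → Obj
  | cogen : ℕ → Obj

local infixr:70 " ⊗ₒ " => Obj.tensor

/-- The upward arrow with label `k`; an arrow with label `0` is erased. -/
def Obj.up : ℕ → Obj
  | 0 => .unit
  | j + 1 => .gen j

/-- Reversing all arrows and the order of the word. -/
def Obj.dual : Obj → Obj
  | .unit => .unit
  | .tensor X Y => Y.dual ⊗ₒ X.dual
  | .gen j => .cogen j
  | .cogen j => .gen j

open Obj (unit gen cogen up)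

/-- Formal `R`-linear combinations of webs drawn as vertical and horizontal compositions of
elementary pieces (read from bottom to top). -/
inductive PreHom (R : Type u) : Obj → Obj → Type u
  | id (X) : PreHom R X X
  | comp {X Y Z} (f : PreHom R X Y) (g : PreHom R Y Z) : PreHom R X Z
  | tens {X X' Y Y'} (f : PreHom R X X') (g : PreHom R Y Y') : PreHom R (X ⊗ₒ Y) (X' ⊗ₒ Y')
  | assoc (X Y Z) : PreHom R ((X ⊗ₒ Y) ⊗ₒ Z) (X ⊗ₒ (Y ⊗ₒ Z))
  | assocInv (X Y Z) : PreHom R (X ⊗ₒ (Y ⊗ₒ Z)) ((X ⊗ₒ Y) ⊗ₒ Z)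
  | lam (X) : PreHom R (unit ⊗ₒ X) X
  | lamInv (X) : PreHom R X (unit ⊗ₒ X)
  | rho (X) : PreHom R (X ⊗ₒ unit) X
  | rhoInv (X) : PreHom R X (X ⊗ₒ unit)
  | zero (X Y) : PreHom R X Y
  | add {X Y} (f g : PreHom R X Y) : PreHom R X Y
  | smul {X Y} (r : R) (f : PreHom R X Y) : PreHom R X Y
  /-- the trivalent vertex merging labels `i + 1` and `j + 1` -/
  | merge (i j m : ℕ) (h : (i + 1) + (j + 1) = m + 1) : PreHom R (gen i ⊗ₒ gen j) (gen m)
  /-- the trivalent vertex splitting into labels `i + 1` and `j + 1` -/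
  | split (i j m : ℕ) (h : (i + 1) + (j + 1) = m + 1) : PreHom R (gen m) (gen i ⊗ₒ gen j)
  /-- cup, oriented leftwards -/
  | cupUD (j : ℕ) : PreHom R unit (gen j ⊗ₒ cogen j)
  /-- cup, oriented rightwards -/
  | cupDU (j : ℕ) : PreHom R unit (cogen j ⊗ₒ gen j)
  /-- cap, oriented leftwards -/
  | capDU (j : ℕ) : PreHom R (cogen j ⊗ₒ gen j) unit
  /-- cap, oriented rightwards -/
  | capUD (j : ℕ) : PreHom R (gen j ⊗ₒ cogen j) unit

namespace PreHom

variable {R : Type u}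

local infixr:60 " ≫ₕ " => PreHom.comp
local infixr:70 " ⊗ₕ " => PreHom.tens

/-- The identity web between two names of the same label. -/
def relabel {k m : ℕ} (h : k = m) : PreHom R (up k) (up m) := h ▸ id (up k)

/-- Merging labels `k` and `l`; if one of them is `0` that edge is erased. -/
def mer : ∀ {k l m : ℕ}, k + l = m → PreHom R (up k ⊗ₒ up l) (up m)
  | 0, l, _, h => lam (up l) ≫ₕ relabel ((Nat.zero_add l).symm.trans h)
  | k + 1, 0, _, h => rho (up (k + 1)) ≫ₕ relabel h
  | k + 1, l + 1, m + 1, h => merge k l m h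

/-- Splitting into labels `k` and `l`; if one of them is `0` that edge is erased. -/
def spl : ∀ {k l m : ℕ}, k + l = m → PreHom R (up m) (up k ⊗ₒ up l)
  | 0, l, _, h => relabel (h.symm.trans (Nat.zero_add l)) ≫ₕ lamInv (up l)
  | k + 1, 0, _, h => relabel h.symm ≫ₕ rhoInv (up (k + 1))
  | k + 1, l + 1, m + 1, h => split k l m h

/-- The ladder with one rung labelled `b` from the left upright to the right one. -/
def rungR {k l k' l' : ℕ} (b : ℕ) (h : k' + b = k) (h' : b + l = l') :
    PreHom R (up k ⊗ₒ up l) (up k' ⊗ₒ up l') :=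
  (spl h ⊗ₕ id (up l)) ≫ₕ assoc _ _ _ ≫ₕ (id (up k') ⊗ₕ mer h')

/-- The ladder with one rung labelled `b` from the right upright to the left one. -/
def rungL {k l k' l' : ℕ} (b : ℕ) (h : k + b = k') (h' : b + l' = l) :
    PreHom R (up k ⊗ₒ up l) (up k' ⊗ₒ up l') :=
  (id (up k) ⊗ₕ spl h') ≫ₕ assocInv _ _ _ ≫ₕ (mer h ⊗ₕ id (up l'))

/-- A web on the first two of three strands. -/
def on12 {X Y X' Y' : Obj} (f : PreHom R (X ⊗ₒ Y) (X' ⊗ₒ Y')) (Z : Obj) :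
    PreHom R ((X ⊗ₒ Y) ⊗ₒ Z) ((X' ⊗ₒ Y') ⊗ₒ Z) :=
  f ⊗ₕ id Z

/-- A web on the last two of three strands. -/
def on23 (X : Obj) {Y Z Y' Z' : Obj} (f : PreHom R (Y ⊗ₒ Z) (Y' ⊗ₒ Z')) :
    PreHom R ((X ⊗ₒ Y) ⊗ₒ Z) ((X ⊗ₒ Y') ⊗ₒ Z') :=
  assoc _ _ _ ≫ₕ (id X ⊗ₕ f) ≫ₕ assocInv _ _ _

/-- Nested cups `unit → X ⊗ X*`. -/
def cupR : (X : Obj) → PreHom R unit (X ⊗ₒ X.dual)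
  | .unit => lamInv unit
  | .tensor X Y =>
      cupR X ≫ₕ (rhoInv X ⊗ₕ id X.dual) ≫ₕ ((id X ⊗ₕ cupR Y) ⊗ₕ id X.dual) ≫ₕ
        (assocInv X Y Y.dual ⊗ₕ id X.dual) ≫ₕ assoc (X ⊗ₒ Y) Y.dual X.dual
  | .gen j => cupUD j
  | .cogen j => cupDU j

/-- Nested cups `unit → X* ⊗ X`. -/
def cupL : (X : Obj) → PreHom R unit (X.dual ⊗ₒ X)
  | .unit => lamInv unit
  | .tensor X Y =>
      cupL Y ≫ₕ (rhoInv Y.dual ⊗ₕ id Y) ≫ₕ ((id Y.dual ⊗ₕ cupL X) ⊗ₕ id Y) ≫ₕ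
        (assocInv Y.dual X.dual X ⊗ₕ id Y) ≫ₕ assoc (Y.dual ⊗ₒ X.dual) X Y
  | .gen j => cupDU j
  | .cogen j => cupUD j

/-- Nested caps `X* ⊗ X → unit`. -/
def capL : (X : Obj) → PreHom R (X.dual ⊗ₒ X) unit
  | .unit => lam unit
  | .tensor X Y =>
      assocInv (Y.dual ⊗ₒ X.dual) X Y ≫ₕ (assoc Y.dual X.dual X ⊗ₕ id Y) ≫ₕ
        ((id Y.dual ⊗ₕ capL X) ⊗ₕ id Y) ≫ₕ (rho Y.dual ⊗ₕ id Y) ≫ₕ capL Y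
  | .gen j => capDU j
  | .cogen j => capUD j

/-- Nested caps `X ⊗ X* → unit`. -/
def capR : (X : Obj) → PreHom R (X ⊗ₒ X.dual) unit
  | .unit => lam unit
  | .tensor X Y =>
      assocInv (X ⊗ₒ Y) Y.dual X.dual ≫ₕ (assoc X Y Y.dual ⊗ₕ id X.dual) ≫ₕ
        ((id X ⊗ₕ capR Y) ⊗ₕ id X.dual) ≫ₕ (rho X ⊗ₕ id X.dual) ≫ₕ capR X
  | .gen j => capUD j
  | .cogen j => capDU j

/-- The web `f` rotated by a half turn counterclockwise. -/
def rotR {X Y : Obj} (f : PreHom R X Y) : PreHom R Y.dual X.dual :=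
  rhoInv Y.dual ≫ₕ (id Y.dual ⊗ₕ (cupR X ≫ₕ (f ⊗ₕ id X.dual))) ≫ₕ
    assocInv Y.dual Y X.dual ≫ₕ (capL Y ⊗ₕ id X.dual) ≫ₕ lam X.dual

/-- The web `f` rotated by a half turn clockwise. -/
def rotL {X Y : Obj} (f : PreHom R X Y) : PreHom R Y.dual X.dual :=
  lamInv Y.dual ≫ₕ ((cupL X ≫ₕ (id X.dual ⊗ₕ f)) ⊗ₕ id Y.dual) ≫ₕ
    assoc X.dual Y Y.dual ≫ₕ (id X.dual ⊗ₕ capR Y) ≫ₕ rho X.dual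

/-- Closing the rightmost strand of `f` around the right. -/
def traceR {A B : Obj} (X : Obj) (f : PreHom R (A ⊗ₒ X) (B ⊗ₒ X)) : PreHom R A B :=
  rhoInv A ≫ₕ (id A ⊗ₕ cupR X) ≫ₕ assocInv A X X.dual ≫ₕ (f ⊗ₕ id X.dual) ≫ₕ
    assoc B X X.dual ≫ₕ (id B ⊗ₕ capR X) ≫ₕ rho B

/-- Closing the leftmost strand of `f` around the left. -/
def traceL {A B : Obj} (X : Obj) (f : PreHom R (X ⊗ₒ A) (X ⊗ₒ B)) : PreHom R A B :=
  lamInv A ≫ₕ (cupL X ⊗ₕ id A) ≫ₕ assoc X.dual X A ≫ₕ (id X.dual ⊗ₕ f) ≫ₕ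
    assocInv X.dual X B ≫ₕ (capL X ⊗ₕ id B) ≫ₕ lam B

/-- Two strands labelled `1` merging into an edge labelled `2` and splitting again. -/
def dumbbell : PreHom R (up 1 ⊗ₒ up 1) (up 1 ⊗ₒ up 1) :=
  mer (m := 2) rfl ≫ₕ spl rfl

/-- The lower half of the mixed square: `dumbbell` rotated by a quarter turn clockwise. -/
def sideR : PreHom R (up 1 ⊗ₒ (up 1).dual) ((up 1).dual ⊗ₒ up 1) :=
  lamInv _ ≫ₕ (cupL (up 1) ⊗ₕ id _) ≫ₕ assoc _ _ _ ≫ₕ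
    (id _ ⊗ₕ (assocInv _ _ _ ≫ₕ (dumbbell ⊗ₕ id _) ≫ₕ assoc _ _ _ ≫ₕ
      (id _ ⊗ₕ capR (up 1)) ≫ₕ rho _))

/-- The upper half of the mixed square: `dumbbell` rotated by a quarter turn counterclockwise. -/
def sideL : PreHom R ((up 1).dual ⊗ₒ up 1) (up 1 ⊗ₒ (up 1).dual) :=
  rhoInv _ ≫ₕ (id _ ⊗ₕ cupR (up 1)) ≫ₕ assocInv _ _ _ ≫ₕ
    ((assoc _ _ _ ≫ₕ (id _ ⊗ₕ dumbbell) ≫ₕ assocInv _ _ _ ≫ₕ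
      (capL (up 1) ⊗ₕ id _) ≫ₕ lam _) ⊗ₕ id _)

/-! #### Relations -/

variable [CommRing R] [Algebra Kq R]

/-- The image in `R` of a rational fraction in `q`. -/
def sc (R : Type u) [CommRing R] [Algebra Kq R] (c : Kq) : R := algebraMap Kq R c

/-- `(a q^{-j} - a⁻¹ q^j) / (q - q⁻¹)`. -/
def aInt (a : Rˣ) (j : ℤ) : R :=
  ((a : R) * sc R (q ^ (-j)) - ((a⁻¹ : Rˣ) : R) * sc R (q ^ j)) * sc R (q - q⁻¹)⁻¹

/-- The relations on webs over a `ℚ(q)`-algebra `R` with a parameter `a ∈ Rˣ`: those of an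
`R`-linear monoidal category, planar isotopy, and the local web relations. -/
inductive Rel (a : Rˣ) : ∀ {X Y : Obj}, PreHom R X Y → PreHom R X Y → Prop
  -- congruence
  | refl {X Y} (f : PreHom R X Y) : Rel a f f
  | symm {X Y} {f g : PreHom R X Y} : Rel a f g → Rel a g f
  | trans {X Y} {f g h : PreHom R X Y} : Rel a f g → Rel a g h → Rel a f h
  | comp {X Y Z} {f f' : PreHom R X Y} {g g' : PreHom R Y Z} :
      Rel a f f' → Rel a g g' → Rel a (f ≫ₕ g) (f' ≫ₕ g')
  | tens {X X' Y Y'} {f f' : PreHom R X X'} {g g' : PreHom R Y Y'} :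
      Rel a f f' → Rel a g g' → Rel a (f ⊗ₕ g) (f' ⊗ₕ g')
  | add {X Y} {f f' g g' : PreHom R X Y} :
      Rel a f f' → Rel a g g' → Rel a (add f g) (add f' g')
  | smul {X Y} (r : R) {f f' : PreHom R X Y} : Rel a f f' → Rel a (smul r f) (smul r f')
  -- linear structure
  | add_assoc {X Y} (f g h : PreHom R X Y) : Rel a (add (add f g) h) (add f (add g h))
  | add_comm {X Y} (f g : PreHom R X Y) : Rel a (add f g) (add g f)
  | zero_add {X Y} (f : PreHom R X Y) : Rel a (add (zero X Y) f) f
  | one_smul {X Y} (f : PreHom R X Y) : Rel a (smul 1 f) f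
  | mul_smul {X Y} (r s : R) (f : PreHom R X Y) : Rel a (smul (r * s) f) (smul r (smul s f))
  | smul_add {X Y} (r : R) (f g : PreHom R X Y) :
      Rel a (smul r (add f g)) (add (smul r f) (smul r g))
  | add_smul {X Y} (r s : R) (f : PreHom R X Y) :
      Rel a (smul (r + s) f) (add (smul r f) (smul s f))
  | zero_smul {X Y} (f : PreHom R X Y) : Rel a (smul 0 f) (zero X Y)
  -- category, with bilinear composition
  | id_comp {X Y} (f : PreHom R X Y) : Rel a (id X ≫ₕ f) f
  | comp_id {X Y} (f : PreHom R X Y) : Rel a (f ≫ₕ id Y) f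
  | comp_assoc {W X Y Z} (f : PreHom R W X) (g : PreHom R X Y) (h : PreHom R Y Z) :
      Rel a ((f ≫ₕ g) ≫ₕ h) (f ≫ₕ (g ≫ₕ h))
  | add_comp {X Y Z} (f f' : PreHom R X Y) (g : PreHom R Y Z) :
      Rel a (add f f' ≫ₕ g) (add (f ≫ₕ g) (f' ≫ₕ g))
  | comp_add {X Y Z} (f : PreHom R X Y) (g g' : PreHom R Y Z) :
      Rel a (f ≫ₕ add g g') (add (f ≫ₕ g) (f ≫ₕ g'))
  | smul_comp {X Y Z} (r : R) (f : PreHom R X Y) (g : PreHom R Y Z) :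
      Rel a (smul r f ≫ₕ g) (smul r (f ≫ₕ g))
  | comp_smul {X Y Z} (f : PreHom R X Y) (r : R) (g : PreHom R Y Z) :
      Rel a (f ≫ₕ smul r g) (smul r (f ≫ₕ g))
  -- monoidal category, with bilinear tensor product
  | id_tens (X Y) : Rel a (id X ⊗ₕ id Y) (id (X ⊗ₒ Y))
  | tens_comp {X₁ Y₁ Z₁ X₂ Y₂ Z₂} (f₁ : PreHom R X₁ Y₁) (f₂ : PreHom R X₂ Y₂)
      (g₁ : PreHom R Y₁ Z₁) (g₂ : PreHom R Y₂ Z₂) :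
      Rel a ((f₁ ⊗ₕ f₂) ≫ₕ (g₁ ⊗ₕ g₂)) ((f₁ ≫ₕ g₁) ⊗ₕ (f₂ ≫ₕ g₂))
  | add_tens {X X' Y Y'} (f f' : PreHom R X X') (g : PreHom R Y Y') :
      Rel a (add f f' ⊗ₕ g) (add (f ⊗ₕ g) (f' ⊗ₕ g))
  | tens_add {X X' Y Y'} (f : PreHom R X X') (g g' : PreHom R Y Y') :
      Rel a (f ⊗ₕ add g g') (add (f ⊗ₕ g) (f ⊗ₕ g'))
  | smul_tens {X X' Y Y'} (r : R) (f : PreHom R X X') (g : PreHom R Y Y') :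
      Rel a (smul r f ⊗ₕ g) (smul r (f ⊗ₕ g))
  | tens_smul {X X' Y Y'} (f : PreHom R X X') (r : R) (g : PreHom R Y Y') :
      Rel a (f ⊗ₕ smul r g) (smul r (f ⊗ₕ g))
  | assoc_hom_inv (X Y Z) : Rel a (assoc X Y Z ≫ₕ assocInv X Y Z) (id _)
  | assoc_inv_hom (X Y Z) : Rel a (assocInv X Y Z ≫ₕ assoc X Y Z) (id _)
  | lam_hom_inv (X) : Rel a (lam X ≫ₕ lamInv X) (id _)
  | lam_inv_hom (X) : Rel a (lamInv X ≫ₕ lam X) (id _)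
  | rho_hom_inv (X) : Rel a (rho X ≫ₕ rhoInv X) (id _)
  | rho_inv_hom (X) : Rel a (rhoInv X ≫ₕ rho X) (id _)
  | assoc_nat {X X' Y Y' Z Z'} (f : PreHom R X X') (g : PreHom R Y Y') (h : PreHom R Z Z') :
      Rel a (((f ⊗ₕ g) ⊗ₕ h) ≫ₕ assoc X' Y' Z') (assoc X Y Z ≫ₕ (f ⊗ₕ (g ⊗ₕ h)))
  | lam_nat {X Y} (f : PreHom R X Y) : Rel a ((id unit ⊗ₕ f) ≫ₕ lam Y) (lam X ≫ₕ f)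
  | rho_nat {X Y} (f : PreHom R X Y) : Rel a ((f ⊗ₕ id unit) ≫ₕ rho Y) (rho X ≫ₕ f)
  | pentagon (W X Y Z) :
      Rel a ((assoc W X Y ⊗ₕ id Z) ≫ₕ assoc W (X ⊗ₒ Y) Z ≫ₕ (id W ⊗ₕ assoc X Y Z))
        (assoc (W ⊗ₒ X) Y Z ≫ₕ assoc W X (Y ⊗ₒ Z))
  | triangle (X Y) : Rel a (assoc X unit Y ≫ₕ (id X ⊗ₕ lam Y)) (rho X ⊗ₕ id Y)
  -- planar isotopy: straightening of strands, and full turns of trivalent vertices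
  | zigzag₁ (j : ℕ) :
      Rel a ((cupUD j ⊗ₕ id (gen j)) ≫ₕ assoc _ _ _ ≫ₕ (id (gen j) ⊗ₕ capDU j))
        (lam _ ≫ₕ rhoInv _)
  | zigzag₂ (j : ℕ) :
      Rel a ((id (cogen j) ⊗ₕ cupUD j) ≫ₕ assocInv _ _ _ ≫ₕ (capDU j ⊗ₕ id (cogen j)))
        (rho _ ≫ₕ lamInv _)
  | zigzag₃ (j : ℕ) :
      Rel a ((cupDU j ⊗ₕ id (cogen j)) ≫ₕ assoc _ _ _ ≫ₕ (id (cogen j) ⊗ₕ capUD j))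
        (lam _ ≫ₕ rhoInv _)
  | zigzag₄ (j : ℕ) :
      Rel a ((id (gen j) ⊗ₕ cupDU j) ≫ₕ assocInv _ _ _ ≫ₕ (capUD j ⊗ₕ id (gen j)))
        (rho _ ≫ₕ lamInv _)
  | rot_merge (i j m : ℕ) (h : (i + 1) + (j + 1) = m + 1) :
      Rel a (rotR (merge i j m h)) (rotL (merge i j m h))
  | rot_split (i j m : ℕ) (h : (i + 1) + (j + 1) = m + 1) :
      Rel a (rotR (split i j m h)) (rotL (split i j m h))
  -- associativity and coassociativity of the vertices
  | mer_assoc {k l r s t m : ℕ} (h₁ : k + l = s) (h₂ : s + r = m) (h₃ : l + r = t)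
      (h₄ : k + t = m) :
      Rel a ((mer h₁ ⊗ₕ id (up r)) ≫ₕ mer h₂) (assoc _ _ _ ≫ₕ (id (up k) ⊗ₕ mer h₃) ≫ₕ mer h₄)
  | spl_assoc {k l r s t m : ℕ} (h₁ : k + l = s) (h₂ : s + r = m) (h₃ : l + r = t)
      (h₄ : k + t = m) :
      Rel a (spl h₂ ≫ₕ (spl h₁ ⊗ₕ id (up r))) (spl h₄ ≫ₕ (id (up k) ⊗ₕ spl h₃) ≫ₕ assocInv _ _ _)
  -- digon removal
  | digon {k l m : ℕ} (h : k + l = m) :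
      Rel a (spl h ≫ₕ mer h)
        (smul (sc R (q ^ (-(k * l : ℤ)) * qIntBinom (k + l) k)) (id (up m)))
  -- square switch, for uprights labelled `k = k' + 1` and `l = l' + 1`
  | square (k' l' : ℕ) :
      Rel a (rungR (k := k' + 1) (l := l' + 1) (k' := k') (l' := l' + 2) 1 (by omega) (by omega) ≫ₕ
          rungL (k' := k' + 1) (l' := l' + 1) 1 (by omega) (by omega))
        (add (rungL (k := k' + 1) (l := l' + 1) (k' := k' + 2) (l' := l') 1
              (by omega) (by omega) ≫ₕ
            rungR (k' := k' + 1) (l' := l' + 1) 1 (by omega) (by omega))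
          (smul (sc R (q ^ (1 - (k' + 1) + (l' + 1) : ℤ) * qInt ((k' + 1) - (l' + 1))))
            (id (up (k' + 1) ⊗ₒ up (l' + 1)))))
  -- cubic (Serre) relations, the third term being zero if an edge has a negative label
  | serre₁ (k l r : ℕ) :
      Rel a
        (add
          (on23 (up k) (rungL (k := l + 2) (l := r + 1) (k' := l + 3) (l' := r) 1
              (by omega) (by omega)) ≫ₕ
            on12 (rungL (k' := k + 2) (l' := l + 1) 2 (by omega) (by omega)) (up r))
          (on12 (rungL (k := k) (l := l + 2) (k' := k + 2) (l' := l) 2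
              (by omega) (by omega)) (up (r + 1)) ≫ₕ
            on23 (up (k + 2)) (rungL (k' := l + 1) (l' := r) 1 (by omega) (by omega))))
        (on12 (rungL (k := k) (l := l + 2) (k' := k + 1) (l' := l + 1) 1
            (by omega) (by omega)) (up (r + 1)) ≫ₕ
          on23 (up (k + 1)) (rungL (k' := l + 2) (l' := r) 1 (by omega) (by omega)) ≫ₕ
          on12 (rungL (k' := k + 2) (l' := l + 1) 1 (by omega) (by omega)) (up r))
  | serre₁' (k r : ℕ) :
      Rel a
        (on23 (up k) (rungL (k := 1) (l := r + 1) (k' := 2) (l' := r) 1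
            (by omega) (by omega)) ≫ₕ
          on12 (rungL (k' := k + 2) (l' := 0) 2 (by omega) (by omega)) (up r))
        (on12 (rungL (k := k) (l := 1) (k' := k + 1) (l' := 0) 1
            (by omega) (by omega)) (up (r + 1)) ≫ₕ
          on23 (up (k + 1)) (rungL (k' := 1) (l' := r) 1 (by omega) (by omega)) ≫ₕ
          on12 (rungL (k' := k + 2) (l' := 0) 1 (by omega) (by omega)) (up r))
  | serre₂ (k l r : ℕ) :
      Rel a
        (add
          (on12 (rungL (k := k) (l := l + 1) (k' := k + 1) (l' := l) 1
              (by omega) (by omega)) (up (r + 2)) ≫ₕ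
            on23 (up (k + 1)) (rungL (k' := l + 2) (l' := r) 2 (by omega) (by omega)))
          (on23 (up k) (rungL (k := l + 1) (l := r + 2) (k' := l + 3) (l' := r) 2
              (by omega) (by omega)) ≫ₕ
            on12 (rungL (k' := k + 1) (l' := l + 2) 1 (by omega) (by omega)) (up r)))
        (on23 (up k) (rungL (k := l + 1) (l := r + 2) (k' := l + 2) (l' := r + 1) 1
            (by omega) (by omega)) ≫ₕ
          on12 (rungL (k' := k + 1) (l' := l + 1) 1 (by omega) (by omega)) (up (r + 1)) ≫ₕ
          on23 (up (k + 1)) (rungL (k' := l + 2) (l' := r) 1 (by omega) (by omega)))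
  | serre₃ (k l r : ℕ) :
      Rel a
        (add
          (on23 (up (k + 2)) (rungR (k := l + 1) (l := r) (k' := l) (l' := r + 1) 1
              (by omega) (by omega)) ≫ₕ
            on12 (rungR (k' := k) (l' := l + 2) 2 (by omega) (by omega)) (up (r + 1)))
          (on12 (rungR (k := k + 2) (l := l + 1) (k' := k) (l' := l + 3) 2
              (by omega) (by omega)) (up r) ≫ₕ
            on23 (up k) (rungR (k' := l + 2) (l' := r + 1) 1 (by omega) (by omega))))
        (on12 (rungR (k := k + 2) (l := l + 1) (k' := k + 1) (l' := l + 2) 1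
            (by omega) (by omega)) (up r) ≫ₕ
          on23 (up (k + 1)) (rungR (k' := l + 1) (l' := r + 1) 1 (by omega) (by omega)) ≫ₕ
          on12 (rungR (k' := k) (l' := l + 2) 1 (by omega) (by omega)) (up (r + 1)))
  | serre₄ (k l r : ℕ) :
      Rel a
        (add
          (on12 (rungR (k := k + 1) (l := l + 2) (k' := k) (l' := l + 3) 1
              (by omega) (by omega)) (up r) ≫ₕ
            on23 (up k) (rungR (k' := l + 1) (l' := r + 2) 2 (by omega) (by omega)))
          (on23 (up (k + 1)) (rungR (k := l + 2) (l := r) (k' := l) (l' := r + 2) 2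
              (by omega) (by omega)) ≫ₕ
            on12 (rungR (k' := k) (l' := l + 1) 1 (by omega) (by omega)) (up (r + 2))))
        (on23 (up (k + 1)) (rungR (k := l + 2) (l := r) (k' := l + 1) (l' := r + 1) 1
            (by omega) (by omega)) ≫ₕ
          on12 (rungR (k' := k) (l' := l + 2) 1 (by omega) (by omega)) (up (r + 1)) ≫ₕ
          on23 (up k) (rungR (k' := l + 1) (l' := r + 2) 1 (by omega) (by omega)))
  | serre₄' (k r : ℕ) :
      Rel a
        (on12 (rungR (k := k + 1) (l := 1) (k' := k) (l' := 2) 1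
            (by omega) (by omega)) (up r) ≫ₕ
          on23 (up k) (rungR (k' := 0) (l' := r + 2) 2 (by omega) (by omega)))
        (on23 (up (k + 1)) (rungR (k := 1) (l := r) (k' := 0) (l' := r + 1) 1
            (by omega) (by omega)) ≫ₕ
          on12 (rungR (k' := k) (l' := 1) 1 (by omega) (by omega)) (up (r + 1)) ≫ₕ
          on23 (up k) (rungR (k' := 0) (l' := r + 2) 1 (by omega) (by omega)))
  -- evaluation of circles labelled `1`
  | circleR : Rel a (cupR (up 1) ≫ₕ capR (up 1)) (smul (aInt a 0) (id unit))
  | circleL : Rel a (cupL (up 1) ≫ₕ capL (up 1)) (smul (aInt a 0) (id unit))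
  -- sideways digons
  | sideDigonR : Rel a (traceR (up 1) dumbbell) (smul (aInt a 1) (id (up 1)))
  | sideDigonL : Rel a (traceL (up 1) dumbbell) (smul (aInt a 1) (id (up 1)))
  -- mixed squares
  | mixedR : Rel a (sideR ≫ₕ sideL)
      (add (id _) (smul (aInt a 2) (capR (up 1) ≫ₕ cupR (up 1))))
  | mixedL : Rel a (sideL ≫ₕ sideR)
      (add (id _) (smul (aInt a 2) (capL (up 1) ≫ₕ cupL (up 1))))

end PreHom

/-- The web category over the `ℚ(q)`-algebra `R` with parameter `a`. -/
def Web (R : Type u) [CommRing R] [Algebra Kq R] (_a : Rˣ) : Type := Obj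

section Category

variable {R : Type u} [CommRing R] [Algebra Kq R] {a : Rˣ}

open PreHom

/-- Equality of webs modulo the relations. -/
def homSetoid (a : Rˣ) (X Y : Obj) : Setoid (PreHom R X Y) :=
  ⟨Rel a, Rel.refl, Rel.symm, Rel.trans⟩

instance : Category.{u} (Web R a) where
  Hom X Y := Quotient (homSetoid a X Y)
  id X := Quotient.mk _ (PreHom.id X)
  comp := Quotient.map₂ PreHom.comp (fun _ _ hf _ _ hg => Rel.comp hf hg)
  id_comp := by rintro X Y ⟨f⟩; exact Quotient.sound (Rel.id_comp f)
  comp_id := by rintro X Y ⟨f⟩; exact Quotient.sound (Rel.comp_id f)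
  assoc := by rintro W X Y Z ⟨f⟩ ⟨g⟩ ⟨h⟩; exact Quotient.sound (Rel.comp_assoc f g h)

/-- A word in arrows as an object of `Web R a`. -/
def of (a : Rˣ) (X : Obj) : Web R a := X

/-- The morphism of `Web R a` represented by a formal combination of webs. -/
def mk (a : Rˣ) {X Y : Obj} (f : PreHom R X Y) : of a X ⟶ of a Y :=
  Quotient.mk (homSetoid a X Y) f

theorem mk_eq {X Y : Obj} {f g : PreHom R X Y} (h : Rel a f g) : mk a f = mk a g :=
  Quotient.sound h

instance : MonoidalCategoryStruct (Web R a) where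
  tensorObj X Y := Obj.tensor X Y
  tensorUnit := Obj.unit
  tensorHom := Quotient.map₂ PreHom.tens (fun _ _ hf _ _ hg => Rel.tens hf hg)
  whiskerLeft X _ _ f := Quotient.map (fun f => PreHom.tens (PreHom.id X) f)
    (fun _ _ hf => Rel.tens (Rel.refl _) hf) f
  whiskerRight f Y := Quotient.map (fun f => PreHom.tens f (PreHom.id Y))
    (fun _ _ hf => Rel.tens hf (Rel.refl _)) f
  associator X Y Z := ⟨mk a (assoc X Y Z), mk a (assocInv X Y Z),
    mk_eq (Rel.assoc_hom_inv X Y Z), mk_eq (Rel.assoc_inv_hom X Y Z)⟩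
  leftUnitor X := ⟨mk a (lam X), mk a (lamInv X), mk_eq (Rel.lam_hom_inv X),
    mk_eq (Rel.lam_inv_hom X)⟩
  rightUnitor X := ⟨mk a (rho X), mk a (rhoInv X), mk_eq (Rel.rho_hom_inv X),
    mk_eq (Rel.rho_inv_hom X)⟩

instance : MonoidalCategory (Web R a) := MonoidalCategory.ofTensorHom
  (id_tensorHom_id := fun X Y => mk_eq (Rel.id_tens X Y))
  (id_tensorHom := by rintro X Y Z ⟨f⟩; rfl)
  (tensorHom_id := by rintro X Y ⟨f⟩ Z; rfl)
  (tensorHom_comp_tensorHom := by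
    rintro _ _ _ _ _ _ ⟨f₁⟩ ⟨f₂⟩ ⟨g₁⟩ ⟨g₂⟩; exact mk_eq (Rel.tens_comp f₁ f₂ g₁ g₂))
  (associator_naturality := by
    rintro _ _ _ _ _ _ ⟨f⟩ ⟨g⟩ ⟨h⟩; exact mk_eq (Rel.assoc_nat f g h))
  (leftUnitor_naturality := by rintro _ _ ⟨f⟩; exact mk_eq (Rel.lam_nat f))
  (rightUnitor_naturality := by rintro _ _ ⟨f⟩; exact mk_eq (Rel.rho_nat f))
  (pentagon := fun W X Y Z => mk_eq (Rel.pentagon W X Y Z))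
  (triangle := fun X Y => mk_eq (Rel.triangle X Y))

instance (X Y : Web R a) : Add (X ⟶ Y) :=
  ⟨Quotient.map₂ PreHom.add (fun _ _ hf _ _ hg => Rel.add hf hg)⟩

instance (X Y : Web R a) : Zero (X ⟶ Y) := ⟨mk a (PreHom.zero X Y)⟩

instance (X Y : Web R a) : Neg (X ⟶ Y) :=
  ⟨Quotient.map (PreHom.smul (-1)) (fun _ _ hf => Rel.smul _ hf)⟩

instance (X Y : Web R a) : AddCommGroup (X ⟶ Y) where
  add_assoc := by rintro ⟨f⟩ ⟨g⟩ ⟨h⟩; exact mk_eq (Rel.add_assoc f g h)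
  add_comm := by rintro ⟨f⟩ ⟨g⟩; exact mk_eq (Rel.add_comm f g)
  zero_add := by rintro ⟨f⟩; exact mk_eq (Rel.zero_add f)
  add_zero := by
    rintro ⟨f⟩; exact mk_eq (Rel.trans (Rel.add_comm f _) (Rel.zero_add f))
  neg_add_cancel := by
    rintro ⟨f⟩
    refine mk_eq (Rel.trans (Rel.add (Rel.refl _) (Rel.symm (Rel.one_smul f))) ?_)
    refine Rel.trans (Rel.symm (Rel.add_smul _ _ f)) ?_
    rw [neg_add_cancel]
    exact Rel.zero_smul f
  nsmul := nsmulRec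
  zsmul := zsmulRec

instance (X Y : Web R a) : Module R (X ⟶ Y) where
  smul r := Quotient.map (PreHom.smul r) (fun _ _ hf => Rel.smul _ hf)
  one_smul := by rintro ⟨f⟩; exact mk_eq (Rel.one_smul f)
  mul_smul := by rintro r s ⟨f⟩; exact mk_eq (Rel.mul_smul r s f)
  smul_add := by rintro r ⟨f⟩ ⟨g⟩; exact mk_eq (Rel.smul_add r f g)
  add_smul := by rintro r s ⟨f⟩; exact mk_eq (Rel.add_smul r s f)
  zero_smul := by rintro ⟨f⟩; exact mk_eq (Rel.zero_smul f)
  smul_zero := by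
    intro r
    refine mk_eq (Rel.trans (Rel.smul r (Rel.symm (Rel.zero_smul (PreHom.zero X Y)))) ?_)
    refine Rel.trans (Rel.symm (Rel.mul_smul r 0 _)) ?_
    rw [mul_zero]
    exact Rel.zero_smul _

instance : Preadditive (Web R a) where
  add_comp := by rintro _ _ _ ⟨f⟩ ⟨f'⟩ ⟨g⟩; exact mk_eq (Rel.add_comp f f' g)
  comp_add := by rintro _ _ _ ⟨f⟩ ⟨g⟩ ⟨g'⟩; exact mk_eq (Rel.comp_add f g g')

instance : Linear R (Web R a) where
  smul_comp := by rintro _ _ _ r ⟨f⟩ ⟨g⟩; exact mk_eq (Rel.smul_comp r f g)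
  comp_smul := by rintro _ _ _ ⟨f⟩ r ⟨g⟩; exact mk_eq (Rel.comp_smul f r g)

theorem whiskerLeft_smul (X : Web R a) {Y Z : Web R a} (r : R) (f : Y ⟶ Z) :
    X ◁ (r • f) = r • (X ◁ f) := by
  obtain ⟨f⟩ := f; exact mk_eq (Rel.tens_smul _ r f)

theorem smul_whiskerRight (r : R) {Y Z : Web R a} (f : Y ⟶ Z) (X : Web R a) :
    (r • f) ▷ X = r • (f ▷ X) := by
  obtain ⟨f⟩ := f; exact mk_eq (Rel.smul_tens r f _)

instance : MonoidalPreadditive (Web R a) where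
  whiskerLeft_zero {X Y Z} := by
    rw [← zero_smul R (0 : Y ⟶ Z), whiskerLeft_smul, zero_smul]
  zero_whiskerRight {X Y Z} := by
    rw [← zero_smul R (0 : Y ⟶ Z), smul_whiskerRight, zero_smul]
  whiskerLeft_add := by rintro X _ _ ⟨f⟩ ⟨g⟩; exact mk_eq (Rel.tens_add _ f g)
  add_whiskerRight := by rintro X _ _ ⟨f⟩ ⟨g⟩; exact mk_eq (Rel.add_tens f g _)

instance : MonoidalLinear R (Web R a) where
  whiskerLeft_smul := whiskerLeft_smul
  smul_whiskerRight := smul_whiskerRight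

end Category

/-! ### Coloured tangle diagrams and their values -/

/-- Oriented coloured tangle diagrams, drawn as compositions of cups, caps and crossings of two
upward strands (read from bottom to top). -/
inductive Diagram : Obj → Obj → Type
  | id (X) : Diagram X X
  | comp {X Y Z} (D : Diagram X Y) (E : Diagram Y Z) : Diagram X Z
  | tens {X X' Y Y'} (D : Diagram X X') (E : Diagram Y Y') : Diagram (X ⊗ₒ Y) (X' ⊗ₒ Y')
  | assoc (X Y Z) : Diagram ((X ⊗ₒ Y) ⊗ₒ Z) (X ⊗ₒ (Y ⊗ₒ Z))
  | assocInv (X Y Z) : Diagram (X ⊗ₒ (Y ⊗ₒ Z)) ((X ⊗ₒ Y) ⊗ₒ Z)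
  | lam (X) : Diagram (unit ⊗ₒ X) X
  | lamInv (X) : Diagram X (unit ⊗ₒ X)
  | rho (X) : Diagram (X ⊗ₒ unit) X
  | rhoInv (X) : Diagram X (X ⊗ₒ unit)
  /-- cup, oriented leftwards -/
  | cupUD (k : ℕ) : Diagram unit (up k ⊗ₒ (up k).dual)
  /-- cup, oriented rightwards -/
  | cupDU (k : ℕ) : Diagram unit ((up k).dual ⊗ₒ up k)
  /-- cap, oriented leftwards -/
  | capDU (k : ℕ) : Diagram ((up k).dual ⊗ₒ up k) unit
  /-- cap, oriented rightwards -/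
  | capUD (k : ℕ) : Diagram (up k ⊗ₒ (up k).dual) unit
  /-- the crossing whose strand from bottom left to top right is over -/
  | over (k l : ℕ) : Diagram (up k ⊗ₒ up l) (up l ⊗ₒ up k)
  /-- the crossing whose strand from bottom right to top left is over -/
  | under (k l : ℕ) : Diagram (up k ⊗ₒ up l) (up l ⊗ₒ up k)

/-- A link diagram is a diagram without end points. -/
abbrev LinkDiagram : Type := Diagram unit unit

section Value

variable {R : Type u} [CommRing R] [Algebra Kq R] (a : Rˣ)

/-- The ladder in the braiding formula for `over`, with lower rung `k - j` to the right and upper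
rung `l - j` to the left. -/
def overTerm (k l : ℕ) (j : Fin (min k l + 1)) : PreHom R (up k ⊗ₒ up l) (up l ⊗ₒ up k) :=
  (PreHom.rungR (k' := j) (l' := k + l - j) (k - j) (by omega) (by omega)).comp
    (PreHom.rungL (l - j) (by omega) (by omega))

/-- The ladder in the braiding formula for `under`, with lower rung `l - j` to the left and upper
rung `k - j` to the right. -/
def underTerm (k l : ℕ) (j : Fin (min k l + 1)) : PreHom R (up k ⊗ₒ up l) (up l ⊗ₒ up k) :=
  (PreHom.rungL (k' := k + l - j) (l' := j) (l - j) (by omega) (by omega)).comp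
    (PreHom.rungR (k - j) (by omega) (by omega))

/-- `(-q)^{kl} ∑ (-q)^{b-k}` (ladder with lower rung `b` and upper rung `c`), the sum being over
`b, c ≥ 0` with `b - c = k - l`; it is indexed by `j = k - b = l - c`. -/
def braiding (k l : ℕ) : of a (up k ⊗ₒ up l) ⟶ of a (up l ⊗ₒ up k) :=
  PreHom.sc R ((-q) ^ (k * l)) •
    ∑ j : Fin (min k l + 1), PreHom.sc R ((-q) ^ (-(j : ℤ))) • mk a (overTerm k l j)

/-- `(-q)^{-kl} ∑ (-q)^{l-b}` (ladder with lower rung `b` and upper rung `c`), the sum being over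
`b, c ≥ 0` with `b - c = l - k`; it is indexed by `j = l - b = k - c`. -/
def braidingInv (k l : ℕ) : of a (up k ⊗ₒ up l) ⟶ of a (up l ⊗ₒ up k) :=
  PreHom.sc R ((-q) ^ (-(k * l : ℤ))) •
    ∑ j : Fin (min k l + 1), PreHom.sc R ((-q) ^ (j : ℕ)) • mk a (underTerm k l j)

/-- The morphism of `Web R a` given by a tangle diagram. -/
def value : ∀ {X Y : Obj}, Diagram X Y → (of a X ⟶ of a Y)
  | _, _, .id X => mk a (.id X)
  | _, _, .comp D E => value D ≫ value E
  | _, _, .tens D E => value D ⊗ₘ value E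
  | _, _, .assoc X Y Z => mk a (.assoc X Y Z)
  | _, _, .assocInv X Y Z => mk a (.assocInv X Y Z)
  | _, _, .lam X => mk a (.lam X)
  | _, _, .lamInv X => mk a (.lamInv X)
  | _, _, .rho X => mk a (.rho X)
  | _, _, .rhoInv X => mk a (.rhoInv X)
  | _, _, .cupUD k => mk a (PreHom.cupR (up k))
  | _, _, .cupDU k => mk a (PreHom.cupL (up k))
  | _, _, .capDU k => mk a (PreHom.capL (up k))
  | _, _, .capUD k => mk a (PreHom.capR (up k))
  | _, _, .over k l => braiding a k l
  | _, _, .under k l => braidingInv a k l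

/-- The value of a link diagram in `End(∅)`. -/
def linkValue (D : LinkDiagram) : 𝟙_ (Web R a) ⟶ 𝟙_ (Web R a) := value a D

/-- The value of the link diagram `D` in `End(∅)` is the scalar `r`. -/
def HasLinkValue (D : LinkDiagram) (r : R) : Prop :=
  linkValue a D = r • 𝟙 (𝟙_ (Web R a))

end Value

/-- The ring `ℚ(q)[a, a⁻¹]`. -/
abbrev Ka : Type := Kq[T;T⁻¹]

/-- The variable `a` of `ℚ(q)[a, a⁻¹]`. -/
def aVar : Kaˣ :=
  ⟨LaurentPolynomial.T 1, LaurentPolynomial.T (-1),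
    by rw [← LaurentPolynomial.T_add]; simp, by rw [← LaurentPolynomial.T_add]; simp⟩

/-- The HOMFLY-PT polynomial of the diagram `D` is `P`. -/
def IsHomflyPT (D : LinkDiagram) (P : Ka) : Prop := HasLinkValue aVar D P

section XInvariant

variable {R : Type u} [CommRing R] [Algebra Kq R]

theorem sq_mul_qDelta {x : ℚ} {ν : R} (hν : ν ^ 2 = algebraMap Kq R (qDelta x)⁻¹) :
    ν * ν * algebraMap Kq R (qDelta x) = 1 := by
  rw [← pow_two, hν, ← map_mul, inv_mul_cancel₀ (qDelta_ne_zero x), map_one]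

/-- `a_x = q ν_x δ_x`, with inverse `q⁻¹ ν_x`. -/
def aSpec (x : ℚ) (ν : R) (hν : ν ^ 2 = algebraMap Kq R (qDelta x)⁻¹) : Rˣ where
  val := algebraMap Kq R q * ν * algebraMap Kq R (qDelta x)
  inv := algebraMap Kq R q⁻¹ * ν
  val_inv := by
    have h := sq_mul_qDelta hν
    have hq : algebraMap Kq R q * algebraMap Kq R q⁻¹ = 1 := by
      rw [← map_mul, mul_inv_cancel₀ q_ne_zero, map_one]
    linear_combination (algebraMap Kq R q * algebraMap Kq R q⁻¹) * h + hq
  inv_val := by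
    have h := sq_mul_qDelta hν
    have hq : algebraMap Kq R q * algebraMap Kq R q⁻¹ = 1 := by
      rw [← map_mul, mul_inv_cancel₀ q_ne_zero, map_one]
    linear_combination (algebraMap Kq R q * algebraMap Kq R q⁻¹) * h + hq

/-- The `x`-invariant of the link diagram `D` is `r`: this is the value at `a = q ν_x δ_x` of the
HOMFLY-PT polynomial of `D`, and the scalar by which `D` acts in the category `xWeb`, that is the
web category with parameter `a = q ν_x δ_x`. -/
def IsXInvariant (x : ℚ) (ν : R) (hν : ν ^ 2 = algebraMap Kq R (qDelta x)⁻¹)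
    (D : LinkDiagram) (r : R) : Prop :=
  (∃ P : Ka, IsHomflyPT D P ∧
    LaurentPolynomial.eval₂ (algebraMap Kq R) (aSpec x ν hν) P = r) ∧
  HasLinkValue (aSpec x ν hν) D r

end XInvariant

/-- The extension `ℚ(q)[ν_x]`, with `ν_x ^ 2 = δ_x⁻¹`. -/
abbrev NuExt (x : ℚ) : Type := AdjoinRoot (Polynomial.X ^ 2 - Polynomial.C (qDelta x)⁻¹)

/-- The element `ν_x` of `ℚ(q)[ν_x]`. -/
def nu (x : ℚ) : NuExt x := AdjoinRoot.root _

theorem nu_sq (x : ℚ) : nu x ^ 2 = algebraMap Kq (NuExt x) (qDelta x)⁻¹ := by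
  have h := AdjoinRoot.eval₂_root (Polynomial.X ^ 2 - Polynomial.C (qDelta x)⁻¹)
  simp only [Polynomial.eval₂_sub, Polynomial.eval₂_pow, Polynomial.eval₂_X,
    Polynomial.eval₂_C] at h
  exact sub_eq_zero.mp h

/-- The once stabilized unknot coloured by `k`: a figure eight whose two strands at the crossing
both point upwards, the strand from bottom right to top left being over; the two left end points
of the crossing are joined around the left, the two right end points around the right. -/
def stabilizedUnknot (k : ℕ) : LinkDiagram :=
  .comp (.lamInv _) <| .comp (.tens (.cupDU k) (.cupUD k)) <|
  .comp (.assoc _ _ _) <| .comp (.tens (.id _) (.assocInv _ _ _)) <|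
  .comp (.tens (.id _) (.tens (.under k k) (.id _))) <|
  .comp (.tens (.id _) (.assoc _ _ _)) <| .comp (.assocInv _ _ _) <|
  .comp (.tens (.capDU k) (.capUD k)) (.lam _)

end

end QWeb

/-!
The figure eight is obtained from its crossing by closing the right strand and then the left one.
Both closures are computed by splitting off strands labelled `1`. Put
`[a; k] = (a q^{-k} - a⁻¹ q^k) / (q - q⁻¹)`. The relation for `EF - FE` and the closures of the
`1 ⊗ 1` webs show that closing the strand `1` of `k ⊗ 1 → k + 1 → k ⊗ 1` gives `[a; k]`. Hence
closing the strand `l` of `k ⊗ l → k + l → k ⊗ l` gives the quantum binomial coefficient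
`[a; k] ⋯ [a; k + l - 1] / [l]!`, and the circle labelled `k` is `[a; 0] ⋯ [a; k - 1] / [k]!`.
By cyclicity each ladder of the crossing contributes a product of two such binomials, and the
alternating sum over the ladders collapses, by the quantum Pascal rule, to the monomial
`q^{k - 2k²} a^k`. Finally `{x} = q² {x - 1} + 1` gives `a [a; i] = q^{i + 1} {x - i}` at
`a = q ν_x δ_x`.
-/

namespace QWeb

noncomputable section

open PreHom (sc aInt)
open Finset.HasAntidiagonal (antidiagonal mem_antidiagonal)

section PartialTrace

universe v w

variable {C : Type w} [Category.{v} C] [MonoidalCategory C]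

section Definitions

variable {X : C} (X' : C) [ExactPairing X X'] [ExactPairing X' X] {A B : C}

/-- The partial trace closing the rightmost strand `X` of `f` around the right, the return strand
being the two-sided dual `X'`. -/
def traceRight (f : A ⊗ X ⟶ B ⊗ X) : A ⟶ B :=
  (ρ_ A).inv ≫ A ◁ η_ X X' ≫ (α_ A X X').inv ≫ f ▷ X' ≫ (α_ B X X').hom ≫ B ◁ ε_ X' X ≫ (ρ_ B).hom

/-- The partial trace closing the leftmost strand `X` of `f` around the left. -/
def traceLeft (f : X ⊗ A ⟶ X ⊗ B) : A ⟶ B :=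
  (λ_ A).inv ≫ η_ X' X ▷ A ≫ (α_ X' X A).hom ≫ X' ◁ f ≫ (α_ X' X B).inv ≫ ε_ X X' ▷ B ≫ (λ_ B).hom

/-- The left trace of an endomorphism: its closure around the left to a morphism of the unit. -/
def loopLeft (f : X ⟶ X) : 𝟙_ C ⟶ 𝟙_ C := η_ X' X ≫ X' ◁ f ≫ ε_ X X'

end Definitions

variable {X Y X' Y' : C} [ExactPairing X X'] [ExactPairing X' X] [ExactPairing Y Y']
  [ExactPairing Y' Y] {A B D : C}

/-- `t` is the rotation of `h` by a half turn, in either direction: sliding `h` through any of the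
four cups and caps turns it into `t`. -/
structure IsRotation (h : X ⟶ Y) (t : Y' ⟶ X') : Prop where
  cupRight : η_ X X' ≫ h ▷ X' = η_ Y Y' ≫ Y ◁ t
  capRight : h ▷ Y' ≫ ε_ Y' Y = X ◁ t ≫ ε_ X' X
  cupLeft : η_ X' X ≫ X' ◁ h = η_ Y' Y ≫ t ▷ Y
  capLeft : Y' ◁ h ≫ ε_ Y Y' = t ▷ X ≫ ε_ X X'

theorem exists_isRotation {h : X ⟶ Y}
    (hh : (ρ_ Y').inv ≫ Y' ◁ η_ X X' ≫ Y' ◁ h ▷ X' ≫ (α_ Y' Y X').inv ≫ ε_ Y Y' ▷ X' ≫ (λ_ X').hom =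
      (λ_ Y').inv ≫ η_ X' X ▷ Y' ≫ (X' ◁ h) ▷ Y' ≫ (α_ X' Y Y').hom ≫ X' ◁ ε_ Y' Y ≫ (ρ_ X').hom) :
    ∃ t : Y' ⟶ X', IsRotation h t := by
  let rightX : HasRightDual X := ⟨X'⟩
  let rightY : HasRightDual Y := ⟨Y'⟩
  let leftX : HasLeftDual X := ⟨X'⟩
  let leftY : HasLeftDual Y := ⟨Y'⟩
  have mates_eq : (hᘁ : Y' ⟶ X') = (ᘁh) := hh
  exact ⟨hᘁ, (coevaluation_comp_rightAdjointMate h).symm,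
    mates_eq ▸ (leftAdjointMate_comp_evaluation h).symm,
    mates_eq ▸ (coevaluation_comp_leftAdjointMate h).symm,
    (rightAdjointMate_comp_evaluation h).symm⟩

theorem exists_isRotation_tensor {Z Z' : C} [ExactPairing Z Z'] [ExactPairing Z' Z]
    {h : X ⊗ Y ⟶ Z}
    (hh : (ρ_ Z').inv ≫ Z' ◁ ((η_ X X' ≫ (ρ_ X).inv ▷ X' ≫ (X ◁ η_ Y Y') ▷ X' ≫
          (α_ X Y Y').inv ▷ X' ≫ (α_ (X ⊗ Y) Y' X').hom) ≫ h ▷ (Y' ⊗ X')) ≫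
          (α_ Z' Z (Y' ⊗ X')).inv ≫ ε_ Z Z' ▷ (Y' ⊗ X') ≫ (λ_ (Y' ⊗ X')).hom =
      (λ_ Z').inv ≫ ((η_ Y' Y ≫ (ρ_ Y').inv ▷ Y ≫ (Y' ◁ η_ X' X) ▷ Y ≫
          (α_ Y' X' X).inv ▷ Y ≫ (α_ (Y' ⊗ X') X Y).hom) ≫ (Y' ⊗ X') ◁ h) ▷ Z' ≫
          (α_ (Y' ⊗ X') Z Z').hom ≫ (Y' ⊗ X') ◁ ε_ Z' Z ≫ (ρ_ (Y' ⊗ X')).hom) :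
    ∃ t : Z' ⟶ Y' ⊗ X', IsRotation h t := by
  refine exists_isRotation (Eq.trans ?_ (hh.trans ?_)) <;>
  · rw [ExactPairing.tensor_coevaluation]; monoidal

theorem coevaluation_unit : η_ (𝟙_ C) (𝟙_ C) = (ρ_ (𝟙_ C)).inv := rfl

theorem evaluation_unit : ε_ (𝟙_ C) (𝟙_ C) = (ρ_ (𝟙_ C)).hom := rfl

theorem isRotation_leftUnitor : IsRotation (λ_ X).hom (ρ_ X').inv := by
  constructor <;>
  · simp only [ExactPairing.tensor_coevaluation, ExactPairing.tensor_evaluation,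
      coevaluation_unit, evaluation_unit]
    monoidal

theorem isRotation_rightUnitor : IsRotation (ρ_ X).hom (λ_ X').inv := by
  constructor <;>
  · simp only [ExactPairing.tensor_coevaluation, ExactPairing.tensor_evaluation,
      coevaluation_unit, evaluation_unit]
    monoidal

theorem traceRight_whiskerRight_comp (g : D ⟶ A) (f : A ⊗ X ⟶ B ⊗ X) :
    traceRight X' (g ▷ X ≫ f) = g ≫ traceRight X' f := by
  calc traceRight X' (g ▷ X ≫ f) =
      (ρ_ D).inv ≫ D ◁ η_ X X' ≫ g ▷ (X ⊗ X') ≫ (α_ A X X').inv ≫ f ▷ X' ≫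
        (α_ B X X').hom ≫ B ◁ ε_ X' X ≫ (ρ_ B).hom := by rw [traceRight]; monoidal
    _ = g ≫ traceRight X' f := by rw [whisker_exchange_assoc, traceRight]; monoidal

theorem traceRight_comp_whiskerRight (f : A ⊗ X ⟶ B ⊗ X) (g : B ⟶ D) :
    traceRight X' (f ≫ g ▷ X) = traceRight X' f ≫ g := by
  calc traceRight X' (f ≫ g ▷ X) =
      (ρ_ A).inv ≫ A ◁ η_ X X' ≫ (α_ A X X').inv ≫ f ▷ X' ≫
        (α_ B X X').hom ≫ g ▷ (X ⊗ X') ≫ D ◁ ε_ X' X ≫ (ρ_ D).hom := by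
        rw [traceRight]; monoidal
    _ = traceRight X' f ≫ g := by rw [← whisker_exchange_assoc, traceRight]; monoidal

theorem traceRight_whiskerLeft (D : C) (f : A ⊗ X ⟶ B ⊗ X) :
    traceRight X' ((α_ D A X).hom ≫ D ◁ f ≫ (α_ D B X).inv) = D ◁ traceRight X' f := by
  rw [traceRight, traceRight]; monoidal

theorem traceRight_id : traceRight X' (𝟙 (A ⊗ X)) =
    (ρ_ A).inv ≫ A ◁ (η_ X X' ≫ ε_ X' X) ≫ (ρ_ A).hom := by
  rw [traceRight]; monoidal

theorem traceRight_unit (f : A ⊗ 𝟙_ C ⟶ B ⊗ 𝟙_ C) :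
    traceRight (𝟙_ C) f = (ρ_ A).inv ≫ f ≫ (ρ_ B).hom := by
  rw [traceRight, coevaluation_unit, evaluation_unit]; monoidal

theorem traceRight_tensor (f : A ⊗ (X ⊗ Y) ⟶ B ⊗ (X ⊗ Y)) :
    traceRight (Y' ⊗ X') f =
      traceRight X' (traceRight Y' ((α_ A X Y).hom ≫ f ≫ (α_ B X Y).inv)) := by
  simp only [traceRight, ExactPairing.tensor_coevaluation, ExactPairing.tensor_evaluation]
  monoidal

theorem traceRight_comp_whiskerLeft_comm {h : X ⟶ Y} {t : Y' ⟶ X'} (ht : IsRotation h t)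
    (f : A ⊗ Y ⟶ B ⊗ X) :
    traceRight Y' (f ≫ B ◁ h) = traceRight X' (A ◁ h ≫ f) := by
  calc traceRight Y' (f ≫ B ◁ h) =
      (ρ_ A).inv ≫ A ◁ η_ Y Y' ≫ (α_ A Y Y').inv ≫ f ▷ Y' ≫ (α_ B X Y').hom ≫
        B ◁ (h ▷ Y' ≫ ε_ Y' Y) ≫ (ρ_ B).hom := by rw [traceRight]; monoidal
    _ = (ρ_ A).inv ≫ A ◁ η_ Y Y' ≫ (α_ A Y Y').inv ≫ (f ▷ Y' ≫ (B ⊗ X) ◁ t) ≫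
        (α_ B X X').hom ≫ B ◁ ε_ X' X ≫ (ρ_ B).hom := by rw [ht.capRight]; monoidal
    _ = (ρ_ A).inv ≫ A ◁ (η_ Y Y' ≫ Y ◁ t) ≫ (α_ A Y X').inv ≫ f ▷ X' ≫
        (α_ B X X').hom ≫ B ◁ ε_ X' X ≫ (ρ_ B).hom := by rw [← whisker_exchange]; monoidal
    _ = traceRight X' (A ◁ h ≫ f) := by rw [← ht.cupRight, traceRight]; monoidal

theorem traceLeft_whiskerLeft_comp (g : D ⟶ A) (f : X ⊗ A ⟶ X ⊗ B) :
    traceLeft X' (X ◁ g ≫ f) = g ≫ traceLeft X' f := by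
  calc traceLeft X' (X ◁ g ≫ f) =
      (λ_ D).inv ≫ η_ X' X ▷ D ≫ (X' ⊗ X) ◁ g ≫ (α_ X' X A).hom ≫ X' ◁ f ≫
        (α_ X' X B).inv ≫ ε_ X X' ▷ B ≫ (λ_ B).hom := by rw [traceLeft]; monoidal
    _ = g ≫ traceLeft X' f := by rw [← whisker_exchange_assoc, traceLeft]; monoidal

theorem traceLeft_comp_whiskerLeft (f : X ⊗ A ⟶ X ⊗ B) (g : B ⟶ D) :
    traceLeft X' (f ≫ X ◁ g) = traceLeft X' f ≫ g := by
  calc traceLeft X' (f ≫ X ◁ g) =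
      (λ_ A).inv ≫ η_ X' X ▷ A ≫ (α_ X' X A).hom ≫ X' ◁ f ≫
        (α_ X' X B).inv ≫ (X' ⊗ X) ◁ g ≫ ε_ X X' ▷ D ≫ (λ_ D).hom := by
        rw [traceLeft]; monoidal
    _ = traceLeft X' f ≫ g := by rw [whisker_exchange_assoc, traceLeft]; monoidal

theorem traceLeft_whiskerRight (f : X ⊗ A ⟶ X ⊗ B) (D : C) :
    traceLeft X' ((α_ X A D).inv ≫ f ▷ D ≫ (α_ X B D).hom) = traceLeft X' f ▷ D := by
  rw [traceLeft, traceLeft]; monoidal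

theorem traceLeft_id : traceLeft X' (𝟙 (X ⊗ A)) =
    (λ_ A).inv ≫ (η_ X' X ≫ ε_ X X') ▷ A ≫ (λ_ A).hom := by
  rw [traceLeft]; monoidal

theorem loopLeft_id : loopLeft X' (𝟙 X) = η_ X' X ≫ ε_ X X' := by
  rw [loopLeft, MonoidalCategory.whiskerLeft_id, Category.id_comp]

theorem loopLeft_tensor (f : X ⊗ Y ⟶ X ⊗ Y) :
    loopLeft (Y' ⊗ X') f = loopLeft Y' (traceLeft X' f) := by
  simp only [loopLeft, traceLeft, ExactPairing.tensor_coevaluation,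
    ExactPairing.tensor_evaluation]
  monoidal

theorem loopLeft_comp_comm {h : X ⟶ Y} {t : Y' ⟶ X'} (ht : IsRotation h t) (f : Y ⟶ X) :
    loopLeft Y' (f ≫ h) = loopLeft X' (h ≫ f) := by
  simp only [loopLeft, MonoidalCategory.whiskerLeft_comp, Category.assoc]
  rw [ht.capLeft, whisker_exchange_assoc, reassoc_of% ht.cupLeft]

theorem figureEight_eq_loopLeft_traceRight (f : X ⊗ Y ⟶ X ⊗ Y) :
    (λ_ (𝟙_ C)).inv ≫ (η_ X' X ⊗ₘ η_ Y Y') ≫ (α_ X' X (Y ⊗ Y')).hom ≫ X' ◁ (α_ X Y Y').inv ≫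
      X' ◁ f ▷ Y' ≫ X' ◁ (α_ X Y Y').hom ≫ (α_ X' X (Y ⊗ Y')).inv ≫ (ε_ X X' ⊗ₘ ε_ Y' Y) ≫
      (λ_ (𝟙_ C)).hom = loopLeft X' (traceRight Y' f) := by
  rw [MonoidalCategory.tensorHom_def, MonoidalCategory.tensorHom_def', loopLeft, traceRight]
  monoidal

section Linear

variable {S : Type u} [CommRing S] [Preadditive C] [Linear S C] [MonoidalPreadditive C]

theorem traceRight_sub (f g : A ⊗ X ⟶ B ⊗ X) :
    traceRight X' (f - g) = traceRight X' f - traceRight X' g := by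
  have h : (f - g) ▷ X' = f ▷ X' - g ▷ X' := (tensorRight X').map_sub
  simp [traceRight, h]

theorem traceRight_sum {ι : Type*} (s : Finset ι) (f : ι → (A ⊗ X ⟶ B ⊗ X)) :
    traceRight X' (∑ i ∈ s, f i) = ∑ i ∈ s, traceRight X' (f i) := by
  simp [traceRight, sum_whiskerRight, Preadditive.comp_sum, Preadditive.sum_comp]

theorem traceLeft_sub (f g : X ⊗ A ⟶ X ⊗ B) :
    traceLeft X' (f - g) = traceLeft X' f - traceLeft X' g := by
  have h : X' ◁ (f - g) = X' ◁ f - X' ◁ g := (tensorLeft X').map_sub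
  simp [traceLeft, h]

variable [MonoidalLinear S C]

theorem traceRight_smul (r : S) (f : A ⊗ X ⟶ B ⊗ X) :
    traceRight X' (r • f) = r • traceRight X' f := by
  simp [traceRight, MonoidalLinear.smul_whiskerRight]

theorem traceLeft_smul (r : S) (f : X ⊗ A ⟶ X ⊗ B) :
    traceLeft X' (r • f) = r • traceLeft X' f := by
  simp [traceLeft, MonoidalLinear.whiskerLeft_smul]

theorem loopLeft_smul (r : S) (f : X ⟶ X) : loopLeft X' (r • f) = r • loopLeft X' f := by
  simp [loopLeft, MonoidalLinear.whiskerLeft_smul]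

theorem traceRight_id_of_circle {r : S} (h : η_ X X' ≫ ε_ X' X = r • 𝟙 (𝟙_ C)) :
    traceRight X' (𝟙 (A ⊗ X)) = r • 𝟙 A := by
  rw [traceRight_id, h]; simp [MonoidalLinear.whiskerLeft_smul]

theorem traceLeft_id_of_circle {r : S} (h : η_ X' X ≫ ε_ X X' = r • 𝟙 (𝟙_ C)) :
    traceLeft X' (𝟙 (X ⊗ A)) = r • 𝟙 A := by
  rw [traceLeft_id, h]; simp [MonoidalLinear.smul_whiskerRight]

end Linear

end PartialTrace

section QuantumIntegers

/-- The symmetric quantum integer `[n] = (q^n - q^{-n}) / (q - q⁻¹)`. -/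
def symInt (n : ℤ) : Kq := (q ^ n - q ^ (-n)) / (q - q⁻¹)

/-- The symmetric quantum factorial `[n]! = [1] ⋯ [n]`. -/
def symFactorial (n : ℕ) : Kq := ∏ i ∈ Finset.range n, symInt (i + 1)

theorem q_sq_sub_one_ne_zero : q ^ 2 - 1 ≠ 0 := sub_ne_zero.mpr (q_pow_ne_one two_ne_zero)

theorem q_sub_inv_eq_div : q - q⁻¹ = (q ^ 2 - 1) / q := by
  have := q_ne_zero
  field_simp

theorem qInt_one : qInt 1 = 1 := div_self q_sq_sub_one_ne_zero

theorem qInt_ne_zero {n : ℤ} (hn : n ≠ 0) : qInt n ≠ 0 :=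
  (hasValue_qInt n).ne_zero (by exact_mod_cast hn)

theorem qInt_eq_zpow_mul_symInt (n : ℤ) : qInt n = q ^ (n - 1) * symInt n := by
  have h0 := q_ne_zero
  have h1 := q_sq_sub_one_ne_zero
  have hn := zpow_ne_zero n h0
  rw [qInt, symInt, q_sub_inv_eq_div, zpow_sub_one₀ h0, two_mul, zpow_add₀ h0, zpow_neg]
  field_simp

theorem zpow_mul_qInt (n : ℤ) : q ^ (1 - n) * qInt n = symInt n := by
  rw [qInt_eq_zpow_mul_symInt, ← mul_assoc, ← zpow_add₀ q_ne_zero, sub_add_sub_cancel, sub_self,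
    zpow_zero, one_mul]

theorem symInt_zero : symInt 0 = 0 := by simp [symInt]

theorem symInt_one : symInt 1 = 1 := by rw [← zpow_mul_qInt, qInt_one, sub_self, zpow_zero, one_mul]

theorem symInt_neg (n : ℤ) : symInt (-n) = -symInt n := by
  rw [symInt, symInt, neg_neg]; ring

theorem symInt_ne_zero {n : ℤ} (hn : n ≠ 0) : symInt n ≠ 0 :=
  right_ne_zero_of_mul (qInt_eq_zpow_mul_symInt n ▸ qInt_ne_zero hn)

theorem symInt_add (m n : ℤ) : symInt (m + n) = q ^ n * symInt m + q ^ (-m) * symInt n := by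
  have h0 := q_ne_zero
  rw [symInt, symInt, symInt, neg_add, zpow_add₀ h0, zpow_add₀ h0]
  field_simp
  ring

theorem zpow_neg_succ_eq (k : ℤ) : q ^ (-(k + 1)) = q⁻¹ * symInt (k + 1) - symInt k := by
  have h := symInt_add (k + 1) (-1)
  rw [add_neg_cancel_right, symInt_neg, symInt_one, zpow_neg_one] at h
  linear_combination h

theorem zpow_succ_eq (k : ℤ) : q ^ (k + 1) = q * symInt (k + 1) - symInt k := by
  have h := symInt_add (-1) (k + 1)
  rw [neg_add_cancel_comm_assoc, symInt_neg, symInt_one, neg_neg, zpow_one] at h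
  linear_combination h

theorem symFactorial_zero : symFactorial 0 = 1 := Finset.prod_range_zero _

theorem symFactorial_succ (n : ℕ) : symFactorial (n + 1) = symFactorial n * symInt (n + 1) :=
  Finset.prod_range_succ _ _

theorem qIntBinom_one (n : ℤ) : qIntBinom n 1 = qInt n := by
  simp [qIntBinom, qInt_one]

theorem qIntBinom_succ_self (k : ℕ) : qIntBinom (k + 1) k = qInt (k + 1) := by
  have numerator : ∏ i ∈ Finset.range k, qInt (k + 1 - i) =
      ∏ i ∈ Finset.range k, qInt ((i + 1 : ℕ) + 1) := by
    rw [← Finset.prod_range_reflect]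
    refine Finset.prod_congr rfl fun i hi => ?_
    have := Finset.mem_range.mp hi
    congr 1; omega
  have shift := Finset.prod_range_succ' (fun i : ℕ => qInt (i + 1)) k
  rw [Finset.prod_range_succ] at shift
  simp only [Nat.cast_zero, zero_add, qInt_one, mul_one] at shift
  rw [qIntBinom, numerator, ← shift]
  exact mul_div_cancel_left₀ _ (Finset.prod_ne_zero_iff.mpr fun i _ => qInt_ne_zero (by omega))

end QuantumIntegers

section QuantumBinomials

variable {R : Type u} [CommRing R] [Algebra Kq R]

theorem sc_mul (x y : Kq) : sc R (x * y) = sc R x * sc R y := map_mul _ _ _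

theorem sc_add (x y : Kq) : sc R (x + y) = sc R x + sc R y := map_add _ _ _

theorem sc_sub (x y : Kq) : sc R (x - y) = sc R x - sc R y := map_sub _ _ _

theorem sc_neg (x : Kq) : sc R (-x) = -sc R x := map_neg _ _

theorem sc_zero : sc R 0 = 0 := map_zero _

theorem sc_one : sc R 1 = 1 := map_one _

theorem isUnit_sc {x : Kq} (hx : x ≠ 0) : IsUnit (sc R x) :=
  (IsUnit.mk0 x hx).map (algebraMap Kq R)

variable (a : Rˣ)

/-- The product `[a; s] [a; s + 1] ⋯ [a; s + n - 1]`, where `[a; j]` is `PreHom.aInt a j`. At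
`a = q ^ N` it is the falling product `[N - s] ⋯ [N - s - n + 1]` of quantum integers. -/
def aFalling (s n : ℕ) : R := ∏ i ∈ Finset.range n, aInt a (s + i : ℕ)

/-- The quantum binomial coefficient `[a; s] ⋯ [a; s + n - 1] / [n]!`; at `a = q ^ N` it is
`N - s` choose `n`. -/
def aBinom (s n : ℕ) : R := sc R (symFactorial n)⁻¹ * aFalling a s n

theorem aFalling_zero (s : ℕ) : aFalling a s 0 = 1 := Finset.prod_range_zero _

theorem aFalling_succ (s n : ℕ) : aFalling a s (n + 1) = aFalling a s n * aInt a (s + n : ℕ) :=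
  Finset.prod_range_succ _ _

theorem aFalling_add (s m n : ℕ) :
    aFalling a s (m + n) = aFalling a s m * aFalling a (s + m) n := by
  simp only [aFalling, Finset.prod_range_add, add_assoc]

theorem aFalling_succ' (s n : ℕ) :
    aFalling a s (n + 1) = aInt a s * aFalling a (s + 1) n := by
  rw [add_comm n, aFalling_add, aFalling_succ, aFalling_zero, one_mul, add_zero]

theorem aBinom_zero (s : ℕ) : aBinom a s 0 = 1 := by
  rw [aBinom, symFactorial_zero, inv_one, sc_one, aFalling_zero, one_mul]

theorem symInt_succ_mul_aBinom_succ (s n : ℕ) :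
    sc R (symInt (n + 1)) * aBinom a s (n + 1) = aBinom a s n * aInt a (s + n : ℕ) := by
  have h : symInt (n + 1) * (symFactorial (n + 1))⁻¹ = (symFactorial n)⁻¹ := by
    rw [symFactorial_succ, mul_inv_rev, mul_inv_cancel_left₀ (symInt_ne_zero (by omega))]
  rw [aBinom, aBinom, aFalling_succ, ← h, sc_mul]; ring

theorem eq_aBinom_succ_smul {M : Type*} [AddCommGroup M] [Module R M] {s n : ℕ} {x y : M}
    (h : sc R (symInt (n + 1)) • x = (aBinom a s n * aInt a (s + n : ℕ)) • y) :
    x = aBinom a s (n + 1) • y := by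
  rw [← symInt_succ_mul_aBinom_succ, mul_smul] at h
  exact (isUnit_sc (symInt_ne_zero (by omega))).smul_left_cancel.mp h

theorem aInt_succ (k : ℤ) :
    aInt a (k + 1) = sc R (symInt (k + 1)) * aInt a 1 - sc R (symInt k) * aInt a 0 := by
  simp only [aInt, zpow_neg_succ_eq, zpow_succ_eq, sc_sub, sc_mul, neg_zero, zpow_zero, sc_one,
    zpow_neg_one, zpow_one]
  ring

theorem zpow_mul_aInt_sub_aInt_add (c n : ℤ) :
    sc R (q ^ n) * aInt a c - aInt a (c + n) = a * sc R (q ^ (-c) * symInt n) := by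
  have h0 := q_ne_zero
  have coeff : q ^ (-c) * symInt n = (q ^ n * q ^ (-c) - q ^ (-(c + n))) * (q - q⁻¹)⁻¹ := by
    rw [symInt, neg_add, zpow_add₀ h0 (-c)]; ring
  rw [coeff, aInt, aInt, zpow_add₀ h0 c]
  simp only [sc_mul, sc_sub]
  ring

end QuantumBinomials

section CurlSum

variable {R : Type u} [CommRing R] [Algebra Kq R]

/-- The coefficient `(-1)^d / ([c]! [d]!)` of the alternating sum `curlSum`. -/
def signedWeight (c d : ℕ) : Kq := (-1) ^ d * (symFactorial c * symFactorial d)⁻¹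

theorem signedWeight_succ_left_mul (c d : ℕ) :
    signedWeight (c + 1) d * symInt (c + 1) = signedWeight c d := by
  have := symInt_ne_zero (n := c + 1) (by omega)
  rw [signedWeight, signedWeight, symFactorial_succ]
  field_simp

theorem signedWeight_succ_right_mul (c d : ℕ) :
    signedWeight c (d + 1) * symInt (d + 1) = -signedWeight c d := by
  have := symInt_ne_zero (n := d + 1) (by omega)
  rw [signedWeight, signedWeight, symFactorial_succ]
  field_simp
  ring

theorem sum_signedWeight_mul_symInt_fst (k : ℕ) (f : ℕ → R) :
    ∑ p ∈ antidiagonal (k + 1), sc R (signedWeight p.1 p.2 * symInt p.1) * f p.1 =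
      ∑ p ∈ antidiagonal k, sc R (signedWeight p.1 p.2) * f (p.1 + 1) := by
  simp only [Finset.Nat.sum_antidiagonal_succ, Nat.cast_zero, symInt_zero, mul_zero, sc_zero,
    zero_mul, zero_add, Nat.cast_succ, signedWeight_succ_left_mul]

theorem sum_signedWeight_mul_symInt_snd (k : ℕ) (f : ℕ → R) :
    ∑ p ∈ antidiagonal (k + 1), sc R (signedWeight p.1 p.2 * symInt p.2) * f p.1 =
      -∑ p ∈ antidiagonal k, sc R (signedWeight p.1 p.2) * f p.1 := by
  simp only [Finset.Nat.sum_antidiagonal_succ', Nat.cast_zero, symInt_zero, mul_zero, sc_zero,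
    zero_mul, zero_add, Nat.cast_succ, signedWeight_succ_right_mul, sc_neg, neg_mul,
    Finset.sum_neg_distrib]

variable (a : Rˣ)

/-- The sum of `(-q)^d / ([c]! [d]!) * [a; s + c] ⋯ [a; s + c + k - 1]` over `c + d = k`. At `s = 0`
it is the scalar of a curl up to normalization; the shift `s` makes it recursive in `k`. -/
def curlSum (k s : ℕ) : R :=
  ∑ p ∈ antidiagonal k,
    sc R (q ^ p.2 * signedWeight p.1 p.2) * aFalling a (s + p.1) k

theorem symInt_mul_curlSum_succ (k s : ℕ) :
    sc R (symInt (k + 1)) * curlSum a (k + 1) s =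
      ∑ p ∈ antidiagonal k, sc R (signedWeight p.1 p.2) *
        (aFalling a (s + p.1 + 1) (k + 1) - sc R (q ^ (k + 1)) * aFalling a (s + p.1) (k + 1)) := by
  have pascal (p : ℕ × ℕ) (hp : p ∈ antidiagonal (k + 1)) :
      symInt (k + 1) * (q ^ p.2 * signedWeight p.1 p.2) =
        signedWeight p.1 p.2 * symInt p.1 + q ^ (k + 1) * (signedWeight p.1 p.2 * symInt p.2) := by
    have hp' : p.1 + p.2 = k + 1 := mem_antidiagonal.mp hp
    have cancel : q ^ p.2 * q ^ (-(p.2 : ℤ)) = 1 := by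
      rw [← zpow_natCast, ← zpow_add₀ q_ne_zero, add_neg_cancel, zpow_zero]
    rw [show (k + 1 : ℤ) = p.2 + p.1 by omega, symInt_add, ← hp', pow_add, zpow_natCast]
    linear_combination (symInt p.1 * signedWeight p.1 p.2) * cancel
  have pascal_sum : sc R (symInt (k + 1)) * curlSum a (k + 1) s =
      ∑ p ∈ antidiagonal (k + 1),
        sc R (signedWeight p.1 p.2 * symInt p.1) * aFalling a (s + p.1) (k + 1) +
      sc R (q ^ (k + 1)) * ∑ p ∈ antidiagonal (k + 1),
        sc R (signedWeight p.1 p.2 * symInt p.2) * aFalling a (s + p.1) (k + 1) := by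
    rw [curlSum, Finset.mul_sum, Finset.mul_sum, ← Finset.sum_add_distrib]
    refine Finset.sum_congr rfl fun p hp => ?_
    rw [← mul_assoc, ← sc_mul, pascal p hp, sc_add, sc_mul (q ^ (k + 1))]
    ring
  rw [pascal_sum, sum_signedWeight_mul_symInt_fst k fun c => aFalling a (s + c) (k + 1),
    sum_signedWeight_mul_symInt_snd k fun c => aFalling a (s + c) (k + 1), mul_neg,
    ← sub_eq_add_neg, Finset.mul_sum, ← Finset.sum_sub_distrib]
  refine Finset.sum_congr rfl fun p _ => ?_
  rw [← add_assoc]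
  ring

theorem curlSum_succ (k s : ℕ) :
    curlSum a (k + 1) s = -a * sc R (q ^ (-(s + k : ℤ))) * curlSum a k (s + 1) := by
  refine (isUnit_sc (symInt_ne_zero (by omega : (k : ℤ) + 1 ≠ 0))).mul_left_cancel ?_
  rw [symInt_mul_curlSum_succ, curlSum, Finset.mul_sum, Finset.mul_sum]
  refine Finset.sum_congr rfl fun p hp => ?_
  have hp' : p.1 + p.2 = k := mem_antidiagonal.mp hp
  have exponent : q ^ (-((s + p.1 : ℕ) : ℤ)) = q ^ (-(s + k : ℤ)) * q ^ p.2 := by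
    rw [← zpow_natCast, ← zpow_add₀ q_ne_zero]; congr 1; omega
  have key := zpow_mul_aInt_sub_aInt_add a (s + p.1 : ℕ) (k + 1 : ℕ)
  rw [exponent, ← Nat.cast_add, zpow_natCast, Nat.cast_succ] at key
  rw [aFalling_succ' a (s + p.1), aFalling_succ, show s + p.1 + 1 + k = s + p.1 + (k + 1) by ring,
    show s + 1 + p.1 = s + p.1 + 1 by ring]
  simp only [sc_mul] at key ⊢
  linear_combination (-(sc R (signedWeight p.1 p.2) * aFalling a (s + p.1 + 1) k)) * key

theorem curlSum_eq (k s : ℕ) :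
    curlSum a k s = (-a : R) ^ k * sc R (q ^ (-(k * s + k * (k - 1)) : ℤ)) := by
  induction k generalizing s with
  | zero => simp [curlSum, signedWeight, aFalling_zero, symFactorial_zero, sc_one]
  | succ k ih =>
    have exponent : q ^ (-((k + 1 : ℕ) * s + (k + 1 : ℕ) * ((k + 1 : ℕ) - 1)) : ℤ) =
        q ^ (-(s + k : ℤ)) * q ^ (-(k * (s + 1 : ℕ) + k * (k - 1)) : ℤ) := by
      rw [← zpow_add₀ q_ne_zero]; congr 1; push_cast; ring
    rw [curlSum_succ, ih, exponent, sc_mul]; ring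

theorem aBinom_mul_aBinom (c d : ℕ) :
    aBinom a c d * aBinom a (c + d) c =
      sc R (symFactorial c * symFactorial d)⁻¹ * aFalling a c (c + d) := by
  rw [aBinom, aBinom, add_comm c d, aFalling_add, add_comm c d, mul_inv, sc_mul]; ring

theorem sum_aBinom_eq_curlSum (k : ℕ) :
    ∑ p ∈ antidiagonal k, sc R ((-q) ^ p.2) * (aBinom a p.1 p.2 * aBinom a k p.1) =
      curlSum a k 0 := by
  refine Finset.sum_congr rfl fun p hp => ?_
  rw [← mem_antidiagonal.mp hp, aBinom_mul_aBinom, ← mul_assoc, ← sc_mul, signedWeight,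
    neg_pow, zero_add, mul_left_comm, mul_assoc]

theorem zpow_mul_sum_aBinom (k : ℕ) :
    sc R ((-q) ^ (-(k * k : ℤ))) * ∑ p ∈ antidiagonal k,
        sc R ((-q) ^ p.2) * (aBinom a p.1 p.2 * aBinom a k p.1) =
      sc R (q ^ (k - 2 * (k * k) : ℤ)) * (a : R) ^ k := by
  have sign : (-q) ^ (-(k * k : ℤ)) * (-1) ^ k = q ^ (-(k * k : ℤ)) := by
    rcases Nat.even_or_odd k with hk | hk
    · have hkk : Even (-(k * k : ℤ)) := (((Int.even_coe_nat k).mpr hk).mul_left k).neg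
      rw [hk.neg_one_pow, hkk.neg_zpow, mul_one]
    · have hkk : Odd (-(k * k : ℤ)) := (((Int.odd_coe_nat k).mpr hk).mul (by exact_mod_cast hk)).neg
      rw [hk.neg_one_pow, hkk.neg_zpow, mul_neg_one, neg_neg]
  have exponent : q ^ (k - 2 * (k * k) : ℤ) =
      q ^ (-(k * k : ℤ)) * q ^ (-(k * (0 : ℕ) + k * (k - 1)) : ℤ) := by
    rw [← zpow_add₀ q_ne_zero]; congr 1; push_cast; ring
  have sc_sign : sc R ((-1) ^ k) = (-1) ^ k := by simp [sc]
  rw [sum_aBinom_eq_curlSum, curlSum_eq, exponent, ← sign, neg_pow (a : R), sc_mul, sc_mul, sc_sign]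
  ring

end CurlSum

section Generators

variable {R : Type u} [CommRing R] [Algebra Kq R] (a : Rˣ)

/-- The upward arrow labelled `k` as an object of the web category; it is the unit for `k = 0`. -/
def upArrow (k : ℕ) : Web R a := of a (Obj.up k)

/-- The downward arrow labelled `k`, the two-sided dual of `upArrow a k`. -/
def downArrow (k : ℕ) : Web R a := of a (Obj.up k).dual

/-- The trivalent vertex merging edges labelled `k` and `l`. The label `m` of the outgoing edge is
a variable, so that no casts between names of the same label are needed. -/
def merge {k l m : ℕ} (h : k + l = m) : upArrow a k ⊗ upArrow a l ⟶ upArrow a m :=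
  mk a (PreHom.mer h)

/-- The trivalent vertex splitting an edge labelled `m` into edges labelled `k` and `l`. -/
def split {k l m : ℕ} (h : k + l = m) : upArrow a m ⟶ upArrow a k ⊗ upArrow a l :=
  mk a (PreHom.spl h)

/-- The web `k ⊗ l → k + l → k ⊗ l`. -/
def dumbbell {k l m : ℕ} (h : k + l = m) : upArrow a k ⊗ upArrow a l ⟶ upArrow a k ⊗ upArrow a l :=
  merge a h ≫ split a h

/-- The ladder `F^{(b)}`, with a rung labelled `b` from the left upright to the right one. -/
def rungRight {k l m n b : ℕ} (h₁ : m + b = k) (h₂ : b + l = n) :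
    upArrow a k ⊗ upArrow a l ⟶ upArrow a m ⊗ upArrow a n :=
  split a h₁ ▷ upArrow a l ≫ (α_ _ _ _).hom ≫ upArrow a m ◁ merge a h₂

/-- The ladder `E^{(b)}`, with a rung labelled `b` from the right upright to the left one. -/
def rungLeft {k l m n b : ℕ} (h₁ : k + b = m) (h₂ : b + n = l) :
    upArrow a k ⊗ upArrow a l ⟶ upArrow a m ⊗ upArrow a n :=
  upArrow a k ◁ split a h₂ ≫ (α_ _ _ _).inv ≫ merge a h₁ ▷ upArrow a n

/-- The ladder `F^{(c)} E^{(c)}` on two uprights labelled `k`, whose right upright is labelled `d`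
between the rungs. -/
def ladder {k c d m : ℕ} (h : k + c = m) (h' : c + d = k) :
    upArrow a k ⊗ upArrow a k ⟶ upArrow a k ⊗ upArrow a k :=
  rungLeft a h h' ≫ rungRight a h h'

instance exactPairingUpDown : ∀ k : ℕ, ExactPairing (upArrow a k) (downArrow a k)
  | 0 => (exactPairingUnit : ExactPairing (𝟙_ (Web R a)) (𝟙_ (Web R a)))
  | j + 1 =>
    { coevaluation' := mk a (PreHom.cupUD j)
      evaluation' := mk a (PreHom.capDU j)
      coevaluation_evaluation' := mk_eq (PreHom.Rel.zigzag₂ j)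
      evaluation_coevaluation' := mk_eq (PreHom.Rel.zigzag₁ j) }

instance exactPairingDownUp : ∀ k : ℕ, ExactPairing (downArrow a k) (upArrow a k)
  | 0 => (exactPairingUnit : ExactPairing (𝟙_ (Web R a)) (𝟙_ (Web R a)))
  | j + 1 =>
    { coevaluation' := mk a (PreHom.cupDU j)
      evaluation' := mk a (PreHom.capUD j)
      coevaluation_evaluation' := mk_eq (PreHom.Rel.zigzag₄ j)
      evaluation_coevaluation' := mk_eq (PreHom.Rel.zigzag₃ j) }

variable {a}

theorem coevaluation_upArrow (k : ℕ) :
    η_ (upArrow a k) (downArrow a k) = mk a (PreHom.cupR (Obj.up k)) := by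
  cases k with
  | zero => exact (unitors_inv_equal (C := Web R a)).symm
  | succ k => rfl

theorem evaluation_upArrow (k : ℕ) :
    ε_ (upArrow a k) (downArrow a k) = mk a (PreHom.capL (Obj.up k)) := by
  cases k with
  | zero => exact (unitors_equal (C := Web R a)).symm
  | succ k => rfl

theorem coevaluation_downArrow (k : ℕ) :
    η_ (downArrow a k) (upArrow a k) = mk a (PreHom.cupL (Obj.up k)) := by
  cases k with
  | zero => exact (unitors_inv_equal (C := Web R a)).symm
  | succ k => rfl

theorem evaluation_downArrow (k : ℕ) :
    ε_ (downArrow a k) (upArrow a k) = mk a (PreHom.capR (Obj.up k)) := by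
  cases k with
  | zero => exact (unitors_equal (C := Web R a)).symm
  | succ k => rfl

theorem merge_zero_left (l : ℕ) : merge a (Nat.zero_add l) = (λ_ (upArrow a l)).hom := by
  have h : ∀ m (h : 0 + l = m) (e : l = m),
      merge a h = (λ_ (upArrow a l)).hom ≫ eqToHom (by rw [e]) := by
    rintro m h rfl
    exact mk_eq (.refl _)
  rw [h _ _ rfl]; exact Category.comp_id _

theorem split_zero_left (l : ℕ) : split a (Nat.zero_add l) = (λ_ (upArrow a l)).inv := by
  have h : ∀ m (h : 0 + l = m) (e : m = l),
      split a h = eqToHom (by rw [e]) ≫ (λ_ (upArrow a l)).inv := by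
    rintro m h rfl
    exact mk_eq (.refl _)
  rw [h _ _ rfl]; exact Category.id_comp _

theorem merge_zero_right (k : ℕ) : merge a (Nat.add_zero k) = (ρ_ (upArrow a k)).hom := by
  cases k with
  | zero => exact (merge_zero_left 0).trans unitors_equal
  | succ k => exact Category.comp_id (ρ_ (upArrow a (k + 1))).hom

theorem split_zero_right (k : ℕ) : split a (Nat.add_zero k) = (ρ_ (upArrow a k)).inv := by
  cases k with
  | zero => exact (split_zero_left 0).trans unitors_inv_equal
  | succ k => exact Category.id_comp (ρ_ (upArrow a (k + 1))).inv

theorem split_merge_zero_left (l : ℕ) :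
    split a (Nat.zero_add l) ≫ merge a (Nat.zero_add l) = 𝟙 (upArrow a l) := by
  rw [split_zero_left, merge_zero_left]; exact (λ_ (upArrow a l)).inv_hom_id

theorem split_merge_zero_right (k : ℕ) :
    split a (Nat.add_zero k) ≫ merge a (Nat.add_zero k) = 𝟙 (upArrow a k) := by
  rw [split_zero_right, merge_zero_right]; exact (ρ_ (upArrow a k)).inv_hom_id

theorem merge_assoc {k l r s t m : ℕ} (h₁ : k + l = s) (h₂ : s + r = m) (h₃ : l + r = t)
    (h₄ : k + t = m) :
    merge a h₁ ▷ upArrow a r ≫ merge a h₂ =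
      (α_ _ _ _).hom ≫ upArrow a k ◁ merge a h₃ ≫ merge a h₄ :=
  mk_eq (PreHom.Rel.mer_assoc h₁ h₂ h₃ h₄)

theorem split_assoc {k l r s t m : ℕ} (h₁ : k + l = s) (h₂ : s + r = m) (h₃ : l + r = t)
    (h₄ : k + t = m) :
    split a h₂ ≫ split a h₁ ▷ upArrow a r =
      split a h₄ ≫ upArrow a k ◁ split a h₃ ≫ (α_ _ _ _).inv :=
  mk_eq (PreHom.Rel.spl_assoc h₁ h₂ h₃ h₄)

theorem split_merge {k l m : ℕ} (h : k + l = m) :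
    split a h ≫ merge a h = sc R (q ^ (-(k * l : ℤ)) * qIntBinom (k + l) k) • 𝟙 (upArrow a m) :=
  mk_eq (PreHom.Rel.digon h)

theorem split_merge_one_right (k : ℕ) :
    split a (rfl : k + 1 = k + 1) ≫ merge a rfl =
      sc R (symInt (k + 1)) • 𝟙 (upArrow a (k + 1)) := by
  rw [split_merge, Nat.cast_one, qIntBinom_succ_self, ← zpow_mul_qInt]; congr 4; ring

theorem split_merge_one_left {k m : ℕ} (h : 1 + k = m) :
    split a h ≫ merge a h = sc R (symInt m) • 𝟙 (upArrow a m) := by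
  rw [split_merge, qIntBinom_one, ← zpow_mul_qInt, ← h]; congr 4; push_cast; ring

theorem square_switch (k l : ℕ) :
    rungRight a (rfl : k + 1 = k + 1) (Nat.add_comm 1 (l + 1)) ≫
        rungLeft a (rfl : k + 1 = k + 1) (Nat.add_comm 1 (l + 1)) =
      rungLeft a (rfl : k + 1 + 1 = k + 2) (Nat.add_comm 1 l) ≫
          rungRight a (rfl : k + 1 + 1 = k + 2) (Nat.add_comm 1 l) +
        sc R (symInt (k - l)) • 𝟙 _ := by
  have coeff : symInt (k - l) = q ^ (1 - (k + 1) + (l + 1) : ℤ) * qInt ((k + 1) - (l + 1)) := by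
    rw [← zpow_mul_qInt]; congr 2 <;> ring
  rw [coeff]
  exact mk_eq (PreHom.Rel.square k l)

theorem rungLeft_zero_right {k b m : ℕ} (h : k + b = m) :
    rungLeft a h (Nat.add_zero b) = merge a h ≫ split a (Nat.add_zero m) := by
  rw [rungLeft, split_zero_right, split_zero_right]
  exact (by monoidal : upArrow a k ◁ (ρ_ (upArrow a b)).inv ≫ (α_ _ _ _).inv ≫ merge a h ▷ 𝟙_ _ =
    merge a h ≫ (ρ_ (upArrow a m)).inv)

theorem rungRight_zero_right {k b m : ℕ} (h : k + b = m) :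
    rungRight a h (Nat.add_zero b) = merge a (Nat.add_zero m) ≫ split a h := by
  rw [rungRight, merge_zero_right, merge_zero_right]
  exact (by monoidal : split a h ▷ 𝟙_ _ ≫ (α_ _ _ _).hom ≫ upArrow a k ◁ (ρ_ (upArrow a b)).hom =
    (ρ_ (upArrow a m)).hom ≫ split a h)

theorem rungRight_zero_left {b l m : ℕ} (h : b + l = m) :
    rungRight a (Nat.zero_add b) h = merge a h ≫ split a (Nat.zero_add m) := by
  rw [rungRight, split_zero_left, split_zero_left]
  exact (by monoidal : (λ_ (upArrow a b)).inv ▷ upArrow a l ≫ (α_ _ _ _).hom ≫ 𝟙_ _ ◁ merge a h =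
    merge a h ≫ (λ_ (upArrow a m)).inv)

theorem rungLeft_zero_left {b l m : ℕ} (h : b + l = m) :
    rungLeft a (Nat.zero_add b) h = merge a (Nat.zero_add m) ≫ split a h := by
  rw [rungLeft, merge_zero_left, merge_zero_left]
  exact (by monoidal : 𝟙_ _ ◁ split a h ≫ (α_ _ _ _).inv ≫ (λ_ (upArrow a b)).hom ▷ upArrow a l =
    (λ_ (upArrow a m)).hom ≫ split a h)

theorem dumbbell_one_right (k : ℕ) :
    dumbbell a (rfl : k + 1 + 1 = k + 2) =
      rungRight a (rfl : k + 1 = k + 1) (rfl : 1 + 1 = 2) ≫ rungLeft a rfl rfl -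
        sc R (symInt k) • 𝟙 _ := by
  have h := square_switch (a := a) k 0
  rw [rungLeft_zero_right, rungRight_zero_right, Category.assoc,
    reassoc_of% (split_merge_zero_right (a := a) (k + 2)), Nat.cast_zero, sub_zero] at h
  exact eq_sub_of_add_eq h.symm

theorem dumbbell_one_left (l : ℕ) :
    dumbbell a (Nat.add_comm 1 (l + 1)) =
      rungLeft a (rfl : 1 + 1 = 2) (Nat.add_comm 1 l) ≫ rungRight a rfl (Nat.add_comm 1 l) -
        sc R (symInt l) • 𝟙 _ := by
  have h := square_switch (a := a) 0 l
  rw [rungRight_zero_left, rungLeft_zero_left, Category.assoc,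
    reassoc_of% (split_merge_zero_left (a := a) (l + 2)), Nat.cast_zero, zero_sub, symInt_neg,
    sc_neg, neg_smul, ← sub_eq_add_neg] at h
  exact h

theorem exists_isRotation_merge {k l m : ℕ} (h : k + l = m) :
    ∃ t : downArrow a m ⟶ downArrow a l ⊗ downArrow a k, IsRotation (merge a h) t := by
  match k, l, m, h with
  | 0, l, m, h =>
    obtain rfl : l = m := by omega
    rw [show merge a h = _ from merge_zero_left l]
    exact ⟨_, isRotation_leftUnitor⟩
  | k + 1, 0, m, h =>
    obtain rfl : k + 1 = m := by omega
    rw [show merge a h = _ from merge_zero_right (k + 1)]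
    exact ⟨_, isRotation_rightUnitor⟩
  | k + 1, l + 1, m + 1, h =>
    exact exists_isRotation_tensor (mk_eq (PreHom.Rel.rot_merge k l m h))

end Generators

section Closures

variable {R : Type u} [CommRing R] [Algebra Kq R] {a : Rˣ}

theorem traceRight_comp_merge {k l m : ℕ} (h : k + l = m) {A B : Web R a}
    (f : A ⊗ upArrow a m ⟶ B ⊗ (upArrow a k ⊗ upArrow a l)) :
    traceRight (downArrow a m) (f ≫ B ◁ merge a h) =
      traceRight (downArrow a k) (traceRight (downArrow a l)
        ((α_ _ _ _).hom ≫ (A ◁ merge a h ≫ f) ≫ (α_ _ _ _).inv)) := by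
  obtain ⟨_, ht⟩ := exists_isRotation_merge (a := a) h
  rw [traceRight_comp_whiskerLeft_comm ht, traceRight_tensor]

theorem loopLeft_comp_merge {k l m : ℕ} (h : k + l = m)
    (f : upArrow a m ⟶ upArrow a k ⊗ upArrow a l) :
    loopLeft (downArrow a m) (f ≫ merge a h) =
      loopLeft (downArrow a l) (traceLeft (downArrow a k) (merge a h ≫ f)) := by
  obtain ⟨_, ht⟩ := exists_isRotation_merge (a := a) h
  rw [loopLeft_comp_comm ht, loopLeft_tensor]

theorem circleRight_one :
    η_ (upArrow a 1) (downArrow a 1) ≫ ε_ (downArrow a 1) (upArrow a 1) = aInt a 0 • 𝟙 _ :=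
  mk_eq PreHom.Rel.circleR

theorem circleLeft_one :
    η_ (downArrow a 1) (upArrow a 1) ≫ ε_ (upArrow a 1) (downArrow a 1) = aInt a 0 • 𝟙 _ :=
  mk_eq PreHom.Rel.circleL

theorem traceRight_dumbbell_one_one :
    traceRight (downArrow a 1) (dumbbell a (rfl : 1 + 1 = 2)) = aInt a 1 • 𝟙 (upArrow a 1) :=
  mk_eq PreHom.Rel.sideDigonR

theorem traceLeft_dumbbell_one_one :
    traceLeft (downArrow a 1) (dumbbell a (rfl : 1 + 1 = 2)) = aInt a 1 • 𝟙 (upArrow a 1) :=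
  mk_eq PreHom.Rel.sideDigonL

theorem traceRight_square (k : ℕ) :
    traceRight (downArrow a 1)
        (rungRight a (rfl : k + 1 = k + 1) (rfl : 1 + 1 = 2) ≫ rungLeft a rfl rfl) =
      (sc R (symInt (k + 1)) * aInt a 1) • 𝟙 (upArrow a (k + 1)) := by
  have square_eq : rungRight a (rfl : k + 1 = k + 1) (rfl : 1 + 1 = 2) ≫ rungLeft a rfl rfl =
      split a rfl ▷ upArrow a 1 ≫ ((α_ _ _ _).hom ≫ upArrow a k ◁ dumbbell a (rfl : 1 + 1 = 2) ≫
        (α_ _ _ _).inv) ≫ merge a (rfl : k + 1 = k + 1) ▷ upArrow a 1 := by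
    simp only [rungRight, rungLeft, dumbbell, MonoidalCategory.whiskerLeft_comp, Category.assoc]
  rw [square_eq, traceRight_whiskerRight_comp, traceRight_comp_whiskerRight,
    traceRight_whiskerLeft, traceRight_dumbbell_one_one, MonoidalLinear.whiskerLeft_smul,
    MonoidalCategory.whiskerLeft_id, Linear.smul_comp, Category.id_comp, Linear.comp_smul,
    split_merge_one_right, smul_smul, mul_comm]

theorem traceLeft_square {l m : ℕ} (h : 1 + l = m) :
    traceLeft (downArrow a 1) (rungLeft a (rfl : 1 + 1 = 2) h ≫ rungRight a rfl h) =
      (sc R (symInt m) * aInt a 1) • 𝟙 (upArrow a m) := by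
  have square_eq : rungLeft a (rfl : 1 + 1 = 2) h ≫ rungRight a rfl h =
      upArrow a 1 ◁ split a h ≫ ((α_ _ _ _).inv ≫ dumbbell a (rfl : 1 + 1 = 2) ▷ upArrow a l ≫
        (α_ _ _ _).hom) ≫ upArrow a 1 ◁ merge a h := by
    simp only [rungRight, rungLeft, dumbbell, comp_whiskerRight, Category.assoc]
  rw [square_eq, traceLeft_whiskerLeft_comp, traceLeft_comp_whiskerLeft,
    traceLeft_whiskerRight, traceLeft_dumbbell_one_one, MonoidalLinear.smul_whiskerRight,
    MonoidalCategory.id_whiskerRight, Linear.smul_comp, Category.id_comp, Linear.comp_smul,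
    split_merge_one_left, smul_smul, mul_comm]

theorem traceRight_dumbbell_one (k : ℕ) :
    traceRight (downArrow a 1) (dumbbell a (rfl : k + 1 = k + 1)) = aInt a k • 𝟙 (upArrow a k) := by
  cases k with
  | zero =>
    have h : dumbbell a (Nat.zero_add 1) = 𝟙 _ := by
      rw [dumbbell, merge_zero_left, split_zero_left]; exact (λ_ (upArrow a 1)).hom_inv_id
    exact (congrArg _ h).trans (traceRight_id_of_circle circleRight_one)
  | succ k =>
    rw [dumbbell_one_right, traceRight_sub, traceRight_smul, traceRight_square,
      traceRight_id_of_circle circleRight_one, smul_smul, ← sub_smul, Nat.cast_succ, aInt_succ]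

theorem traceLeft_dumbbell_one {l m : ℕ} (h : 1 + l = m) :
    traceLeft (downArrow a 1) (dumbbell a h) = aInt a l • 𝟙 (upArrow a l) := by
  cases l with
  | zero =>
    obtain rfl : 1 = m := h
    have h : dumbbell a (Nat.add_zero 1) = 𝟙 _ := by
      rw [dumbbell, merge_zero_right, split_zero_right]; exact (ρ_ (upArrow a 1)).hom_inv_id
    exact (congrArg _ h).trans (traceLeft_id_of_circle circleLeft_one)
  | succ l =>
    obtain rfl : l + 2 = m := by omega
    rw [dumbbell_one_left, traceLeft_sub, traceLeft_smul, traceLeft_square,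
      traceLeft_id_of_circle circleLeft_one, smul_smul, ← sub_smul, Nat.cast_succ, aInt_succ]

theorem traceRight_dumbbell_succ {k l m : ℕ} (h : k + (l + 1) = m + 1) (h' : k + l = m) :
    sc R (symInt (l + 1)) • traceRight (downArrow a (l + 1)) (dumbbell a h) =
      aInt a m • traceRight (downArrow a l) (dumbbell a h') := by
  have digon : dumbbell a h ≫ upArrow a k ◁ (split a (rfl : l + 1 = l + 1) ≫ merge a rfl) =
      sc R (symInt (l + 1)) • dumbbell a h := by
    rw [split_merge_one_right, MonoidalLinear.whiskerLeft_smul,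
      MonoidalCategory.whiskerLeft_id, Linear.comp_smul, Category.comp_id]
  have assoc : (α_ (upArrow a k) (upArrow a l) (upArrow a 1)).hom ≫
      (upArrow a k ◁ merge a (rfl : l + 1 = l + 1) ≫ dumbbell a h ≫ upArrow a k ◁ split a rfl) ≫
        (α_ _ _ _).inv =
      merge a h' ▷ upArrow a 1 ≫ dumbbell a (rfl : m + 1 = m + 1) ≫
        split a h' ▷ upArrow a 1 := by
    simp only [dumbbell, Category.assoc]
    rw [split_assoc h' rfl rfl h, reassoc_of% (merge_assoc (a := a) h' rfl rfl h)]
  rw [← traceRight_smul, ← digon, MonoidalCategory.whiskerLeft_comp, ← Category.assoc,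
    traceRight_comp_merge, assoc, traceRight_whiskerRight_comp, traceRight_comp_whiskerRight,
    traceRight_dumbbell_one, Linear.smul_comp, Category.id_comp, Linear.comp_smul,
    traceRight_smul, dumbbell]

theorem traceRight_dumbbell {k l m : ℕ} (h : k + l = m) :
    traceRight (downArrow a l) (dumbbell a h) = aBinom a k l • 𝟙 (upArrow a k) := by
  induction l generalizing m with
  | zero =>
    obtain rfl : k = m := h
    rw [dumbbell, merge_zero_right, split_zero_right, aBinom_zero, one_smul]
    have unit : traceRight (𝟙_ _) ((ρ_ (upArrow a k)).hom ≫ (ρ_ (upArrow a k)).inv) = 𝟙 _ := by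
      simp [traceRight_unit]
    exact unit
  | succ l ih =>
    obtain rfl : k + l + 1 = m := h
    refine eq_aBinom_succ_smul a ?_
    rw [traceRight_dumbbell_succ _ rfl, ih, smul_smul, mul_comm]

theorem loopLeft_id_succ (k : ℕ) :
    sc R (symInt (k + 1)) • loopLeft (downArrow a (k + 1)) (𝟙 (upArrow a (k + 1))) =
      aInt a k • loopLeft (downArrow a k) (𝟙 (upArrow a k)) := by
  have h := loopLeft_comp_merge (a := a) (Nat.add_comm 1 k) (split a (Nat.add_comm 1 k))
  rwa [split_merge_one_left, ← dumbbell, traceLeft_dumbbell_one, loopLeft_smul, loopLeft_smul,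
    Nat.cast_succ] at h

theorem loopLeft_id_upArrow (k : ℕ) :
    loopLeft (downArrow a k) (𝟙 (upArrow a k)) = aBinom a 0 k • 𝟙 (𝟙_ (Web R a)) := by
  induction k with
  | zero =>
    rw [aBinom_zero, one_smul]
    exact loopLeft_id.trans (ρ_ (𝟙_ (Web R a))).inv_hom_id
  | succ k ih =>
    refine eq_aBinom_succ_smul a ?_
    rw [loopLeft_id_succ, ih, smul_smul, mul_comm, zero_add]

theorem traceRight_ladder {k c d m : ℕ} (h : k + c = m) (h' : c + d = k) :
    traceRight (downArrow a k) (ladder a h h') =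
      (aBinom a c d * aBinom a k c) • 𝟙 (upArrow a k) := by
  have cyclic := traceRight_comp_merge h' (upArrow a k ◁ split a h' ≫ (α_ _ _ _).inv ≫
    dumbbell a h ▷ upArrow a d ≫ (α_ _ _ _).hom)
  have rotated : (α_ (upArrow a k) (upArrow a c) (upArrow a d)).hom ≫
      (upArrow a k ◁ merge a h' ≫ upArrow a k ◁ split a h' ≫ (α_ _ _ _).inv ≫
        dumbbell a h ▷ upArrow a d ≫ (α_ _ _ _).hom) ≫ (α_ _ _ _).inv =
      ((α_ _ _ _).hom ≫ upArrow a k ◁ dumbbell a h' ≫ (α_ _ _ _).inv) ≫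
        dumbbell a h ▷ upArrow a d := by
    simp [dumbbell]
  rw [rotated, traceRight_comp_whiskerRight, traceRight_whiskerLeft, traceRight_dumbbell,
    MonoidalLinear.whiskerLeft_smul, MonoidalCategory.whiskerLeft_id, Linear.smul_comp,
    Category.id_comp, traceRight_smul, traceRight_dumbbell, smul_smul] at cyclic
  rw [← cyclic]
  simp only [ladder, rungLeft, rungRight, dumbbell, comp_whiskerRight, Category.assoc]

end Closures

section StabilizedUnknot

variable {R : Type u} [CommRing R] [Algebra Kq R] (a : Rˣ)

/-- The crossing of two upward strands labelled `k`, the one from bottom right being over. -/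
def crossing (k : ℕ) : upArrow a k ⊗ upArrow a k ⟶ upArrow a k ⊗ upArrow a k := braidingInv a k k

theorem crossing_eq_sum_ladders (k : ℕ) :
    crossing a k = sc R ((-q) ^ (-(k * k : ℤ))) • ∑ d : Fin (min k k + 1), sc R ((-q) ^ (d : ℕ)) •
      ladder a (by omega : k + (k - d) = k + k - d) (by omega : k - d + d = k) :=
  rfl

theorem traceRight_crossing (k : ℕ) :
    traceRight (downArrow a k) (crossing a k) =
      (sc R (q ^ (k - 2 * (k * k) : ℤ)) * (a : R) ^ k) • 𝟙 (upArrow a k) := by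
  have reindex : ∑ d : Fin (min k k + 1),
      sc R ((-q) ^ (d : ℕ)) * (aBinom a (k - d) d * aBinom a k (k - d)) =
      ∑ p ∈ antidiagonal k, sc R ((-q) ^ p.2) * (aBinom a p.1 p.2 * aBinom a k p.1) := by
    rw [Fin.sum_univ_eq_sum_range
        fun d => sc R ((-q) ^ d) * (aBinom a (k - d) d * aBinom a k (k - d)), min_self,
      ← Finset.Nat.sum_antidiagonal_swap, Finset.Nat.sum_antidiagonal_eq_sum_range_succ_mk]
    rfl
  rw [← zpow_mul_sum_aBinom, ← reindex, crossing_eq_sum_ladders, traceRight_smul, traceRight_sum,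
    mul_smul, Finset.sum_smul]
  simp only [traceRight_smul, traceRight_ladder, smul_smul]

theorem linkValue_stabilizedUnknot (k : ℕ) :
    linkValue a (stabilizedUnknot k) =
      loopLeft (downArrow a k) (traceRight (downArrow a k) (crossing a k)) := by
  rw [← figureEight_eq_loopLeft_traceRight, coevaluation_upArrow, coevaluation_downArrow,
    evaluation_upArrow, evaluation_downArrow]
  rfl

/-- The coloured HOMFLY-PT polynomial of the once stabilized unknot. -/
def unknotValue (k : ℕ) : R := sc R (q ^ (k - 2 * (k * k) : ℤ)) * (a : R) ^ k * aBinom a 0 k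

theorem hasLinkValue_stabilizedUnknot (k : ℕ) :
    HasLinkValue a (stabilizedUnknot k) (unknotValue a k) := by
  rw [HasLinkValue, linkValue_stabilizedUnknot, traceRight_crossing, loopLeft_smul,
    loopLeft_id_upArrow, smul_smul, unknotValue]

end StabilizedUnknot

section Rational

theorem q_zpow_two_mul (n : ℤ) : q ^ (2 * n) = q ^ 2 * q ^ (2 * (n - 1)) := by
  rw [← zpow_natCast, ← zpow_add₀ q_ne_zero]; congr 1; push_cast; ring

theorem qInt_eq_sq_mul_add_one (n : ℤ) : qInt n = q ^ 2 * qInt (n - 1) + 1 := by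
  have := q_sq_sub_one_ne_zero
  rw [qInt, qInt, q_zpow_two_mul n]
  field_simp
  ring

theorem qCF_cons_eq_sq_mul_add_one (n b : ℤ) (l : List ℤ) :
    qCF (n :: b :: l) = q ^ 2 * qCF ((n - 1) :: b :: l) + 1 := by
  cases l with
  | nil => rw [qCF, qCF, qInt_eq_sq_mul_add_one n, q_zpow_two_mul n]; ring
  | cons c l => rw [qCF, qCF, qInt_eq_sq_mul_add_one n, q_zpow_two_mul n]; ring

theorem exists_evenCF_eq_cons (x : ℚ) :
    ∃ b l, evenCF x = (⌈x⌉ - 1) :: b :: l ∧ evenCF (x - 1) = (⌈x⌉ - 1 - 1) :: b :: l := by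
  have fract_eq : (x - 1 - ((⌈x⌉ - 1 - 1 : ℤ) : ℚ))⁻¹ = (x - ((⌈x⌉ - 1 : ℤ) : ℚ))⁻¹ := by
    push_cast; ring
  rw [evenCF.eq_1 x, evenCF.eq_1 (x - 1)]
  simp only [Int.ceil_sub_one, fract_eq]
  split_ifs <;> exact ⟨_, _, rfl, rfl⟩

theorem qRat_eq_sq_mul_add_one (x : ℚ) : qRat x = q ^ 2 * qRat (x - 1) + 1 := by
  obtain ⟨b, l, hx, hx'⟩ := exists_evenCF_eq_cons x
  rw [qRat, qRat, hx, hx', qCF_cons_eq_sq_mul_add_one]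

theorem qRat_sub_natCast (x : ℚ) (i : ℕ) :
    (q ^ 2 - 1) * qRat (x - i) + 1 = q ^ (-2 * i : ℤ) * (q ^ 2 * qDelta x) := by
  induction i with
  | zero =>
    simp only [Nat.cast_zero, sub_zero, mul_zero, zpow_zero, one_mul, qDelta]
    linear_combination -qRat_eq_sq_mul_add_one x
  | succ i ih =>
    have shift : q ^ (-2 * i : ℤ) = q ^ (-2 * (i + 1 : ℕ) : ℤ) * q ^ 2 := by
      rw [← zpow_natCast, ← zpow_add₀ q_ne_zero]; congr 1; push_cast; ring
    rw [shift] at ih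
    rw [Nat.cast_succ, ← sub_sub]
    refine mul_left_cancel₀ (pow_ne_zero 2 q_ne_zero) ?_
    linear_combination ih - (q ^ 2 - 1) * qRat_eq_sq_mul_add_one (x - i)

theorem zpow_mul_qRat_sub_natCast (x : ℚ) (i : ℕ) :
    q ^ (i + 1 : ℤ) * qRat (x - i) =
      (q ^ 2 * qDelta x * q ^ (-i : ℤ) - q ^ (i : ℤ)) * (q - q⁻¹)⁻¹ := by
  have h0 := q_ne_zero
  have double : q ^ (-2 * i : ℤ) = q ^ (-i : ℤ) * q ^ (-i : ℤ) := by
    rw [← zpow_add₀ h0]; congr 1; ring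
  have cancel : q ^ (i : ℤ) * q ^ (-i : ℤ) = 1 := by
    rw [← zpow_add₀ h0, add_neg_cancel, zpow_zero]
  have h := qRat_sub_natCast x i
  rw [double] at h
  rw [q_sub_inv_eq_div, inv_div, ← mul_div_assoc, eq_div_iff q_sq_sub_one_ne_zero,
    zpow_add_one₀ h0]
  linear_combination (q ^ (i : ℤ) * q) * h + (q ^ (-i : ℤ) * q ^ 2 * qDelta x * q) * cancel

theorem qBinom_one (x : ℚ) : qBinom x 1 = qRat x := by simp [qBinom, qInt_one]

theorem qBinom_succ (x : ℚ) (k : ℕ) :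
    qBinom x (k + 1) = qBinom x k * (qRat (x - k) / qInt (k + 1)) := by
  rw [qBinom, qBinom, Finset.prod_range_succ, Finset.prod_range_succ, mul_div_mul_comm]

end Rational

section Specialization

variable {R : Type u} [CommRing R] [Algebra Kq R]

theorem unknotValue_succ (a : Rˣ) (k : ℕ) :
    unknotValue a (k + 1) =
      unknotValue a k * sc R (q ^ (-(4 * k + 1) : ℤ) / symInt (k + 1)) * (a * aInt a k) := by
  have exponent : q ^ ((k + 1 : ℕ) - 2 * ((k + 1 : ℕ) * (k + 1 : ℕ)) : ℤ) =
      q ^ (k - 2 * (k * k) : ℤ) * q ^ (-(4 * k + 1) : ℤ) := by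
    rw [← zpow_add₀ q_ne_zero]; congr 1; push_cast; ring
  rw [unknotValue, unknotValue, aBinom, aBinom, symFactorial_succ, aFalling_succ, exponent,
    mul_inv, div_eq_mul_inv, zero_add]
  simp only [sc_mul]
  ring

theorem aSpec_mul_self {x : ℚ} {ν : R} (hν : ν ^ 2 = algebraMap Kq R (qDelta x)⁻¹) :
    (aSpec x ν hν : R) * aSpec x ν hν = sc R (q ^ 2 * qDelta x) := by
  simp only [aSpec, sc, map_mul, map_pow]
  linear_combination (algebraMap Kq R q ^ 2 * algebraMap Kq R (qDelta x)) * sq_mul_qDelta hν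

theorem aSpec_mul_aInt {x : ℚ} {ν : R} (hν : ν ^ 2 = algebraMap Kq R (qDelta x)⁻¹) (i : ℕ) :
    (aSpec x ν hν : R) * aInt (aSpec x ν hν) i = sc R (q ^ (i + 1 : ℤ) * qRat (x - i)) := by
  rw [zpow_mul_qRat_sub_natCast, sc_mul, sc_sub, sc_mul _ (q ^ (-i : ℤ)), ← aSpec_mul_self hν, aInt]
  linear_combination (-sc R (q ^ (i : ℤ)) * sc R (q - q⁻¹)⁻¹) * (aSpec x ν hν).mul_inv

theorem unknotValue_aSpec {x : ℚ} {ν : R} (hν : ν ^ 2 = algebraMap Kq R (qDelta x)⁻¹) (k : ℕ) :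
    unknotValue (aSpec x ν hν) k = sc R (q ^ (-(k * (k - 1) : ℤ)) * qBinom x k) := by
  have h0 := q_ne_zero
  induction k with
  | zero => simp [unknotValue, aBinom_zero, qBinom, sc_one]
  | succ k ih =>
    have exponent : q ^ (-((k + 1 : ℕ) * ((k + 1 : ℕ) - 1) : ℤ)) =
        q ^ (-(k * (k - 1) : ℤ)) * q ^ (-(4 * k + 1) : ℤ) * q ^ (k + 1 : ℤ) *
          q ^ ((k : ℤ) + 1 - 1) := by
      rw [← zpow_add₀ h0, ← zpow_add₀ h0, ← zpow_add₀ h0]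
      congr 1; push_cast; ring
    have hk := zpow_ne_zero ((k : ℤ) + 1 - 1) h0
    rw [unknotValue_succ, ih, aSpec_mul_aInt, ← sc_mul, ← sc_mul, qBinom_succ, exponent,
      qInt_eq_zpow_mul_symInt]
    congr 1
    field_simp

theorem eval₂_unknotValue (b : Rˣ) (k : ℕ) :
    LaurentPolynomial.eval₂ (algebraMap Kq R) b (unknotValue aVar k) = unknotValue b k := by
  have eval_sc (c : Kq) : LaurentPolynomial.eval₂ (algebraMap Kq R) b (sc Ka c) = sc R c :=
    LaurentPolynomial.eval₂_C _ _ _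
  have eval_aVar : LaurentPolynomial.eval₂ (algebraMap Kq R) b (aVar : Ka) = b := by
    simp [aVar]
  have eval_aVar_inv :
      LaurentPolynomial.eval₂ (algebraMap Kq R) b ((aVar⁻¹ : Kaˣ) : Ka) = (b⁻¹ : Rˣ) := by
    rw [show ((aVar⁻¹ : Kaˣ) : Ka) = LaurentPolynomial.T (-1) from rfl]; simp
  simp only [unknotValue, aBinom, aFalling, aInt, map_mul, map_pow, map_prod, map_sub, eval_sc,
    eval_aVar, eval_aVar_inv]

theorem isXInvariant_stabilizedUnknot {x : ℚ} {ν : R}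
    (hν : ν ^ 2 = algebraMap Kq R (qDelta x)⁻¹) (k : ℕ) :
    IsXInvariant x ν hν (stabilizedUnknot k)
      (algebraMap Kq R (q ^ (-(k * (k - 1) : ℤ)) * qBinom x k)) := by
  rw [← sc, ← unknotValue_aSpec hν]
  exact ⟨⟨_, hasLinkValue_stabilizedUnknot aVar k, eval₂_unknotValue _ k⟩,
    hasLinkValue_stabilizedUnknot _ k⟩

end Specialization

end

end QWeb

theorem mainTheorem3 {R : Type*} [CommRing R] [Algebra QWeb.Kq R] (x : ℚ) (ν : R)
    (hν : ν ^ 2 = algebraMap QWeb.Kq R (QWeb.qDelta x)⁻¹) :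
    QWeb.IsXInvariant x ν hν (QWeb.stabilizedUnknot 1) (algebraMap QWeb.Kq R (QWeb.qRat x)) ∧
    ∀ k : ℕ, 1 ≤ k →
      QWeb.IsXInvariant x ν hν (QWeb.stabilizedUnknot k)
        (algebraMap QWeb.Kq R (QWeb.q ^ (-(k * (k - 1) : ℤ)) * QWeb.qBinom x k)) := by
  refine ⟨?_, fun k _ => QWeb.isXInvariant_stabilizedUnknot hν k⟩
  simpa [QWeb.qBinom_one] using QWeb.isXInvariant_stabilizedUnknot hν 1
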